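/- Let $K$ be an arbitrary field and let $\Lambda=\Lambda(x_i\mid i\ge 0)$ be the Grassmann algebra over $K$ in countably many variables, with its $\mathbb Z_2$-grading (all $x_i$ odd). We write $x_i$ also for the left multiplication by $x_i$, and $\partial_i$ for the superderivative of $\Lambda$ with $\partial_i(x_j)=\delta_{ij}$. Then $\operatorname{End}\Lambda$ is an associative superalgebra, and a Lie superalgebra under the supercommutator $[a,b]=ab-(-1)^{|a||b|}ba$, with the quadratic map $a\mapsto a^2$ on odd elements. Define the odd endomorphisms $$v_i=\partial_i+x_ix_{i+1}\bigl(\partial_{i+3}+x_{i+3}x_{i+4}\bigl(\partial_{i+6}+x_{i+6}x_{i+7}(\partial_{i+9}+\cdots)\bigr)\bigr),\qquad i\ge 0,$$ and let $\mathbf Q=\mathrm{Lie}(v_0,v_1,v_2)\subset\operatorname{End}\Lambda$ be the Lie superalgebra generated by $v_0,v_1,v_2$. (In characteristic $2$, Lie superalgebras and their ideals are required to be closed under squares of odd elements; in other characteristics this is automatic.) *Basis monomials.* For a finite set $S=\{i_1<\dots<i_t\}$ of nonnegative integers and $n\ge 0$ consider $x_Sv_n=x_{i_1}\cdots x_{i_t}v_n$;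 the number $n$ is its length. It is a standard monomial of the first type if $i\le n-3$ for all $i\in S$, unless $n=4$ and $0\in S$, or $n=7$ and $\{0,3\}\subseteq S$. It is a standard monomial of the second type if $n\ge 3$, $n-2\in S$ and $i\le n-5$ for all other $i\in S$, unless $n\in\{5,7\}$ and $0\in S$, or $n=10$ and $\{0,3,5\}\subseteq S$. The basis monomials of $\mathbf Q$ are the standard monomials of both types if $\operatorname{char}K\ne 2$, and the standard monomials of the first type together with the squares $v_{n-3}^2=x_{n-2}v_n$, $n\ge 3$, if $\operatorname{char}K=2$. For $m\ge 1$ let $\mathbf Q(m)$ be the linear span of the basis monomials of length at least $m$, and let $x_0\mathbf Q(m)$ denote the linear span of those basis monomials of length at least $m$ that involve $x_0$ (i.e. $0\in S$). A Lie superalgebra is *just infinite* if it is infinite-dimensional and each of its nonzero ideals (graded or not) has finite codimension; it is *hereditary just infinite* if each of its graded ideals of finite codimension is just infinite. **Theorem.** 1. Every nonzero ideal of $\mathbf Q$ has finite codimension in $\mathbf Q$, and $\mathbf Q$ is just infinite. 2. For every $m\ge 1$, $\mathbf Q(m)$ is a graded ideal of $\mathbf Q$ of finite codimension, and $x_0\mathbf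 Q(m)$ is a nonzero graded abelian ideal of $\mathbf Q(m)$ that has infinite codimension in $\mathbf Q(m)$. Hence $\mathbf Q(m)$ is not just infinite. 3. In particular, $\mathbf Q$ is not hereditary just infinite. -/

import Mathlib

noncomputable section

namespace FractalQ

/-! ### The general linear superalgebra of a `ℤ/2`-graded vector space -/

/-- `End_s V`: endomorphisms that map `V_t` into `V_{s+t}` for every `t`
(`s = 0` even, `s = 1` odd). -/
def endPart {K V : Type*} [Field K] [AddCommGroup V] [Module K V]
    (𝒱 : ZMod 2 → Submodule K V) (s : ZMod 2) : Submodule K (Module.End K V) where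
  carrier := {T | ∀ t : ZMod 2, ∀ f ∈ 𝒱 t, T f ∈ 𝒱 (s + t)}
  add_mem' := fun ha hb t f hf => Submodule.add_mem _ (ha t f hf) (hb t f hf)
  zero_mem' := fun _ _ _ => Submodule.zero_mem _
  smul_mem' := fun c _ ha t f hf => Submodule.smul_mem _ c (ha t f hf)

/-- The projection of `V = V_0 ⊕ V_1` onto `V_t`, as an endomorphism of `V`. -/
def parityProj {K V : Type*} [Field K] [AddCommGroup V] [Module K V]
    (𝒱 : ZMod 2 → Submodule K V) [DirectSum.Decomposition 𝒱] (t : ZMod 2) : Module.End K V :=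
  (𝒱 t).subtype ∘ₗ DirectSum.component K (ZMod 2) (fun i => 𝒱 i) t ∘ₗ
    (DirectSum.decomposeLinearEquiv 𝒱).toLinearMap

/-- The component of parity `s` of an endomorphism of `V = V_0 ⊕ V_1`. -/
def parityComponent {K V : Type*} [Field K] [AddCommGroup V] [Module K V]
    (𝒱 : ZMod 2 → Submodule K V) [DirectSum.Decomposition 𝒱] (s : ZMod 2)
    (T : Module.End K V) : Module.End K V :=
  ∑ t : ZMod 2, parityProj 𝒱 (s + t) * T * parityProj 𝒱 t

/-- The supercommutator on `End V`: the bilinear map with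
`[a, b] = a b - (-1)^{|a||b|} b a` for homogeneous `a`, `b`. -/
def superBracket {K V : Type*} [Field K] [AddCommGroup V] [Module K V]
    (𝒱 : ZMod 2 → Submodule K V) [DirectSum.Decomposition 𝒱] (a b : Module.End K V) :
    Module.End K V :=
  ∑ s : ZMod 2, ∑ t : ZMod 2,
    (parityComponent 𝒱 s a * parityComponent 𝒱 t b
      - (-1 : K) ^ (s.val * t.val) • (parityComponent 𝒱 t b * parityComponent 𝒱 s a))

/-! ### Lie superalgebras of endomorphisms of `V`, and their ideals -/

/-- A subspace of `End V` is graded if it is the sum of its even and odd parts. -/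
def IsGraded {K V : Type*} [Field K] [AddCommGroup V] [Module K V]
    (𝒱 : ZMod 2 → Submodule K V) [DirectSum.Decomposition 𝒱]
    (L : Submodule K (Module.End K V)) : Prop :=
  ∀ s : ZMod 2, ∀ a ∈ L, parityComponent 𝒱 s a ∈ L

/-- `L` is a Lie sub-superalgebra of `End V`. The square `a ↦ a²` of odd elements is the quadratic
mapping of the Lie superalgebra in characteristic `2`; in any other characteristic
`a² = [a, a] / 2`, so that closure under it follows from closure under the bracket. -/
structure IsLieSubsuperalgebra {K V : Type*} [Field K] [AddCommGroup V] [Module K V]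
    (𝒱 : ZMod 2 → Submodule K V) [DirectSum.Decomposition 𝒱]
    (L : Submodule K (Module.End K V)) : Prop where
  graded : IsGraded 𝒱 L
  bracket_mem : ∀ a ∈ L, ∀ b ∈ L, superBracket 𝒱 a b ∈ L
  square_mem : ∀ a ∈ L, a ∈ endPart 𝒱 1 → a * a ∈ L

/-- The Lie superalgebra generated by a set `X` of endomorphisms of `V`. -/
def lieGenerated {K V : Type*} [Field K] [AddCommGroup V] [Module K V]
    (𝒱 : ZMod 2 → Submodule K V) [DirectSum.Decomposition 𝒱] (X : Set (Module.End K V)) :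
    Submodule K (Module.End K V) :=
  sInf {L | IsLieSubsuperalgebra 𝒱 L ∧ X ⊆ L}

/-- `I` is a two-sided ideal of the Lie superalgebra `L`; it is not required to be graded.
In characteristic `2` an ideal is closed under the quadratic mapping; in any other
characteristic this closure is automatic. -/
structure IsIdealOf {K V : Type*} [Field K] [AddCommGroup V] [Module K V]
    (𝒱 : ZMod 2 → Submodule K V) [DirectSum.Decomposition 𝒱]
    (I L : Submodule K (Module.End K V)) : Prop where
  le : I ≤ L
  left_mem : ∀ q ∈ L, ∀ a ∈ I, superBracket 𝒱 q a ∈ I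
  right_mem : ∀ q ∈ L, ∀ a ∈ I, superBracket 𝒱 a q ∈ I
  square_mem : ∀ a ∈ I, a ∈ endPart 𝒱 1 → a * a ∈ I

/-- `I` has finite codimension in `L` (used for `I ≤ L`). -/
def FiniteCodimIn {K V : Type*} [Field K] [AddCommGroup V] [Module K V]
    (I L : Submodule K (Module.End K V)) : Prop :=
  FiniteDimensional K (L ⧸ I.submoduleOf L)

/-- Zero bracket (and zero quadratic mapping, which only matters in characteristic `2`). -/
def IsAbelian {K V : Type*} [Field K] [AddCommGroup V] [Module K V]
    (𝒱 : ZMod 2 → Submodule K V) [DirectSum.Decomposition 𝒱]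
    (J : Submodule K (Module.End K V)) : Prop :=
  (∀ a ∈ J, ∀ b ∈ J, superBracket 𝒱 a b = 0) ∧ ∀ a ∈ J, a ∈ endPart 𝒱 1 → a * a = 0

/-- `L` is just infinite: it is infinite-dimensional and each nonzero ideal of it, graded or not,
has finite codimension. -/
def JustInfinite {K V : Type*} [Field K] [AddCommGroup V] [Module K V]
    (𝒱 : ZMod 2 → Submodule K V) [DirectSum.Decomposition 𝒱]
    (L : Submodule K (Module.End K V)) : Prop :=
  ¬ FiniteDimensional K L ∧
    ∀ I : Submodule K (Module.End K V), IsIdealOf 𝒱 I L → I ≠ ⊥ → FiniteCodimIn I L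

/-- `L` is hereditary just infinite: each (graded) ideal of finite codimension, which is then a Lie
superalgebra itself, is just infinite. -/
def HereditaryJustInfinite {K V : Type*} [Field K] [AddCommGroup V] [Module K V]
    (𝒱 : ZMod 2 → Submodule K V) [DirectSum.Decomposition 𝒱]
    (L : Submodule K (Module.End K V)) : Prop :=
  ∀ H : Submodule K (Module.End K V),
    IsIdealOf 𝒱 H L → IsGraded 𝒱 H → FiniteCodimIn H L → JustInfinite 𝒱 H

/-! ### The Grassmann algebra, the pivot elements and the Lie superalgebra `Q` -/

/-- The Grassmann algebra `Λ = Λ(x_i | i ≥ 0)` in countably many variables over `K`. -/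
abbrev Grassmann (K : Type*) [Field K] : Type _ := ExteriorAlgebra K (ℕ →₀ K)

/-- The Grassmann letter `x_i`. -/
def letter (K : Type*) [Field K] (i : ℕ) : Grassmann K :=
  ExteriorAlgebra.ι K (Finsupp.single i 1)

/-- The superderivative `∂_i` of `Λ`, with `∂_i (x_j) = δ_{ij}`: it is the odd endomorphism with
`∂_i (x_j * f) = δ_{ij} f - x_j * ∂_i f`. -/
def partialD (K : Type*) [Field K] (i : ℕ) : Module.End K (Grassmann K) :=
  CliffordAlgebra.contractLeft (Q := (0 : QuadraticForm K (ℕ →₀ K))) (Finsupp.lapply i)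

/-- The component of parity `s` of the Grassmann algebra (`0` even, `1` odd). -/
abbrev grassmannPart (K : Type*) [Field K] (s : ZMod 2) : Submodule K (Grassmann K) :=
  CliffordAlgebra.evenOdd (0 : QuadraticForm K (ℕ →₀ K)) s

/-- `pivotCoeff K i k = (x_i x_{i+1}) (x_{i+3} x_{i+4}) ⋯ (x_{i+3(k-1)} x_{i+3(k-1)+1})`. -/
def pivotCoeff (K : Type*) [Field K] : ℕ → ℕ → Grassmann K
  | _, 0 => 1
  | i, k + 1 => letter K i * letter K (i + 1) * pivotCoeff K (i + 3) k

theorem eventually_partialD_eq_zero (K : Type*) [Field K] (f : Grassmann K) :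
    ∃ N : ℕ, ∀ n, N ≤ n → partialD K n f = 0 := by
  induction f using CliffordAlgebra.left_induction with
  | algebraMap r => exact ⟨0, fun n _ => by rw [partialD, CliffordAlgebra.contractLeft_algebraMap]⟩
  | add f g hf hg =>
    obtain ⟨N, hN⟩ := hf
    obtain ⟨M, hM⟩ := hg
    refine ⟨max N M, fun n hn => ?_⟩
    rw [map_add, hN n (le_trans (le_max_left _ _) hn), hM n (le_trans (le_max_right _ _) hn),
      add_zero]
  | ι_mul f m hf =>
    obtain ⟨N, hN⟩ := hf
    obtain ⟨M, hM⟩ := m.support.bddAbove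
    refine ⟨max N (M + 1), fun n hn => ?_⟩
    have h1 : m n = 0 := by
      by_contra h
      have : n ≤ M := hM (Finset.mem_coe.2 (Finsupp.mem_support_iff.2 h))
      have := le_trans (le_max_right N (M + 1)) hn
      omega
    have h2 := hN n (le_trans (le_max_left _ _) hn)
    unfold partialD at h2 ⊢
    rw [CliffordAlgebra.contractLeft_ι_mul, h2, Finsupp.lapply_apply, h1, zero_smul, mul_zero,
      sub_zero]

theorem finite_support_pivot (K : Type*) [Field K] (i : ℕ) (f : Grassmann K) :
    (Function.support fun k : ℕ => pivotCoeff K i k * partialD K (i + 3 * k) f).Finite := by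
  obtain ⟨N, hN⟩ := eventually_partialD_eq_zero K f
  refine (Set.finite_Iio N).subset fun k hk => ?_
  by_contra h
  refine hk ?_
  have h' : N ≤ i + 3 * k := by
    have : N ≤ k := by simpa using h
    omega
  simp [hN _ h']

/-- The pivot element
`v_i = ∂_i + x_i x_{i+1} (∂_{i+3} + x_{i+3} x_{i+4} (∂_{i+6} + ⋯))`, an endomorphism of `Λ`;
on each element of `Λ` only finitely many terms of the sum are nonzero. -/
def pivot (K : Type*) [Field K] (i : ℕ) : Module.End K (Grassmann K) where
  toFun f := ∑ᶠ k : ℕ, pivotCoeff K i k * partialD K (i + 3 * k) f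
  map_add' f g := by
    rw [← finsum_add_distrib (finite_support_pivot K i f) (finite_support_pivot K i g)]
    simp only [map_add, mul_add]
  map_smul' c f := by
    rw [RingHom.id_apply, smul_finsum' c (finite_support_pivot K i f)]
    simp only [map_smul, mul_smul_comm]

/-- The Lie superalgebra `Q = Lie(v_0, v_1, v_2)`. -/
def superQ (K : Type*) [Field K] : Submodule K (Module.End K (Grassmann K)) :=
  lieGenerated (grassmannPart K) {pivot K 0, pivot K 1, pivot K 2}

/-! ### The basis monomials of `Q` -/

/-- The operator `x_{i_1} ⋯ x_{i_t} v_n`, where `S = {i_1 < ⋯ < i_t}`. -/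
def monomialOp (K : Type*) [Field K] (S : Finset ℕ) (n : ℕ) : Module.End K (Grassmann K) :=
  LinearMap.mulLeft K (((S.sort (· ≤ ·)).map (letter K)).prod) * pivot K n

/-- `x_S v_n` is a standard monomial of the first type: `r_{n-3} v_n` with
`r_{n-3} = x_0^* ⋯ x_{n-3}^*`, except `x_0 x_1^* v_4` and `x_0 x_1^* x_2^* x_3 x_4^* v_7`. -/
def IsFirstType (S : Finset ℕ) (n : ℕ) : Prop :=
  (∀ i ∈ S, i + 3 ≤ n) ∧ ¬ (n = 4 ∧ 0 ∈ S) ∧ ¬ (n = 7 ∧ 0 ∈ S ∧ 3 ∈ S)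

/-- `x_S v_n` is a standard monomial of the second type: `r_{n-5} x_{n-2} v_n` with `n ≥ 3`, except
`x_0 x_3 v_5`, `x_0 x_1^* x_2^* x_5 v_7` and `x_0 x_1^* x_2^* x_3 x_4^* x_5 x_8 v_10`. -/
def IsSecondType (S : Finset ℕ) (n : ℕ) : Prop :=
  3 ≤ n ∧ n - 2 ∈ S ∧ (∀ i ∈ S, i = n - 2 ∨ i + 5 ≤ n) ∧
    ¬ (n = 5 ∧ 0 ∈ S) ∧ ¬ (n = 7 ∧ 0 ∈ S) ∧ ¬ (n = 10 ∧ 0 ∈ S ∧ 3 ∈ S ∧ 5 ∈ S)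

/-- `x_S v_n` belongs to the monomial basis of `Q`, which consists of the standard monomials of both
types if `char K ≠ 2`, and of those of the first type and the squares
`v_{n-3}² = x_{n-2} v_n`, `n ≥ 3`, if `char K = 2`. The number `n` is the length. -/
def IsBasisMonomial (K : Type*) [Field K] (S : Finset ℕ) (n : ℕ) : Prop :=
  IsFirstType S n ∨ ((2 : K) ≠ 0 ∧ IsSecondType S n) ∨ ((2 : K) = 0 ∧ 3 ≤ n ∧ S = {n - 2})

/-- `Q(m)`: the span of the basis monomials of length at least `m`. -/
def superQFrom (K : Type*) [Field K] (m : ℕ) : Submodule K (Module.End K (Grassmann K)) :=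
  Submodule.span K {T | ∃ S n, IsBasisMonomial K S n ∧ m ≤ n ∧ T = monomialOp K S n}

/-- `x_0 Q(m)`: the span of the basis monomials of length at least `m` that involve `x_0`. -/
def superQFromX0 (K : Type*) [Field K] (m : ℕ) : Submodule K (Module.End K (Grassmann K)) :=
  Submodule.span K {T | ∃ S n, IsBasisMonomial K S n ∧ m ≤ n ∧ 0 ∈ S ∧ T = monomialOp K S n}

end FractalQ

end

/-! The pivot elements satisfy $v_i^2=x_{i+1}v_{i+3}$, $[v_i,v_{i+1}]=-x_iv_{i+3}$,
$[v_i,v_{i+2}]=-x_ix_{i+1}x_{i+2}v_{i+5}$, and $[v_n,v_m]=x_nx_{n+1}[v_{n+3},v_m]$ for $m\ge n+2$.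
Hence $[v_n,v_m]$ is always a multiple of one monomial (`exists_anti`). A bracket of monomials keeps
the coarse shape of the two types and never decreases the length (`superBracket_mem`). The
exceptions in small lengths come from a grading. Give $v_n$ weight `wt n` and $x_n$ weight `-wt n`,
where `wt` satisfies the recursion forced by the relations and is 1, 0, 0 on the generators. The
excluded monomials are exactly those of the right shape with negative weight
(`isBasisMonomial_iff`), and additivity of the weight keeps them from appearing. So the basis
monomials span a Lie superalgebra. Conversely, every basis monomial is obtained from a maximal one
by removing letters through brackets with pivots, and the maximal ones are explicit brackets. This
gives `superQ_eq`.

Part 1. On a given element of $\Lambda$ almost all $v_m$ vanish, so a nonzero element of an ideal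
has a leading term $f v_n$ with $f\ne0$. Bracketing with pivots differentiates $f$ down to a
constant, which yields $v_n+R'$ with $R'$ of larger length. For all large $p$, the double bracket
$[x_nv_p,[\,\cdot\,,x_0\cdots x_pv_{p+3}]]$ annihilates $R'$ and sends $v_n$ to $\pm x_0\cdots
x_{p-1}v_{p+3}$. These monomials generate all basis monomials of large length, so the ideal contains
some $\mathbf Q(m)$ (`exists_superQFrom_le`), which has finite codimension because there are
finitely many basis monomials of each length. The ideal is not assumed graded: only brackets with
homogeneous elements of $\mathbf Q$ and squares of pivots are used.

Parts 2 and 3. For $n\ge1$ the pivot $v_n$ does not differentiate $x_0$. So $x_0$ survives brackets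
inside $\mathbf Q(m)$ with $m\ge1$, and a product of two operators involving $x_0$ contains
$x_0^2=0$. The pivots themselves remain independent modulo $x_0\mathbf Q(m)$, as the constant terms
of the values at the letters show (`symbolMap`). -/

noncomputable section

namespace FractalQ

/-! ### Superbrackets, spans of homogeneous operators and codimension -/

section General

variable {K V : Type*} [Field K] [AddCommGroup V] [Module K V]

theorem mul_mem_endPart {𝒱 : ZMod 2 → Submodule K V} {s t : ZMod 2} {a b : Module.End K V}
    (ha : a ∈ endPart 𝒱 s) (hb : b ∈ endPart 𝒱 t) : a * b ∈ endPart 𝒱 (s + t) := by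
  intro u f hf
  rw [add_assoc]
  exact ha _ _ (hb _ _ hf)

variable (𝒱 : ZMod 2 → Submodule K V) [DirectSum.Decomposition 𝒱]

theorem parityProj_apply (t : ZMod 2) (f : V) :
    parityProj 𝒱 t f = (DirectSum.decompose 𝒱 f t : V) := rfl

theorem parityProj_of_mem {t : ZMod 2} {f : V} (hf : f ∈ 𝒱 t) : parityProj 𝒱 t f = f := by
  rw [parityProj_apply, DirectSum.decompose_of_mem_same 𝒱 hf]

theorem parityProj_of_mem_ne {s t : ZMod 2} {f : V} (hf : f ∈ 𝒱 t) (h : t ≠ s) :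
    parityProj 𝒱 s f = 0 := by
  rw [parityProj_apply, DirectSum.decompose_of_mem_ne 𝒱 hf h]

theorem parityProj_mem (t : ZMod 2) (f : V) : parityProj 𝒱 t f ∈ 𝒱 t := by
  rw [parityProj_apply]; exact SetLike.coe_mem _

theorem sum_parityProj (f : V) : ∑ t : ZMod 2, parityProj 𝒱 t f = f := by
  classical
  conv_rhs => rw [← DirectSum.sum_support_decompose 𝒱 f]
  refine (Finset.sum_subset (Finset.subset_univ _) fun t _ ht => ?_).symm
  rw [DFinsupp.notMem_support_iff] at ht
  rw [parityProj_apply, ht]; rfl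

theorem parityComponent_of_mem {s : ZMod 2} {T : Module.End K V} (hT : T ∈ endPart 𝒱 s) :
    parityComponent 𝒱 s T = T := by
  ext f
  simp only [parityComponent, LinearMap.sum_apply, Module.End.mul_apply]
  rw [Finset.sum_congr rfl fun t _ => parityProj_of_mem 𝒱 (hT t _ (parityProj_mem 𝒱 t f)),
    ← map_sum, sum_parityProj]

theorem parityComponent_of_mem_ne {s s' : ZMod 2} {T : Module.End K V} (hT : T ∈ endPart 𝒱 s)
    (h : s ≠ s') : parityComponent 𝒱 s' T = 0 := by
  ext f
  simp only [parityComponent, LinearMap.sum_apply, Module.End.mul_apply]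
  refine Finset.sum_eq_zero fun t _ => parityProj_of_mem_ne 𝒱 (hT t _ (parityProj_mem 𝒱 t f)) ?_
  simpa using h

theorem parityComponent_mem (s : ZMod 2) (T : Module.End K V) :
    parityComponent 𝒱 s T ∈ endPart 𝒱 s := by
  intro t f hf
  simp only [parityComponent, LinearMap.sum_apply, Module.End.mul_apply]
  rw [Finset.sum_eq_single t (fun u _ hu => by
    rw [parityProj_of_mem_ne 𝒱 hf hu.symm, map_zero, map_zero]) (by simp)]
  exact parityProj_mem 𝒱 _ _

/-- `parityComponent` as a linear map. -/
def parityComponentHom (s : ZMod 2) : Module.End K V →ₗ[K] Module.End K V where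
  toFun := parityComponent 𝒱 s
  map_add' a b := by
    simp only [parityComponent, mul_add, add_mul, Finset.sum_add_distrib]
  map_smul' c a := by
    simp only [parityComponent, mul_smul_comm, smul_mul_assoc, Finset.smul_sum, RingHom.id_apply]

/-- `superBracket` as a bilinear map. -/
def superBracketHom : Module.End K V →ₗ[K] Module.End K V →ₗ[K] Module.End K V :=
  LinearMap.mk₂ K (superBracket 𝒱)
    (fun a a' b => by
      simp only [superBracket, ← Finset.sum_add_distrib]
      refine Finset.sum_congr rfl fun s _ => Finset.sum_congr rfl fun t _ => ?_
      rw [show parityComponent 𝒱 s (a + a') = parityComponent 𝒱 s a + parityComponent 𝒱 s a' from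
        map_add (parityComponentHom 𝒱 s) a a']
      simp only [mul_add, add_mul, smul_add]; abel)
    (fun c a b => by
      simp only [superBracket, Finset.smul_sum]
      refine Finset.sum_congr rfl fun s _ => Finset.sum_congr rfl fun t _ => ?_
      rw [show parityComponent 𝒱 s (c • a) = c • parityComponent 𝒱 s a from
        map_smul (parityComponentHom 𝒱 s) c a]
      simp only [mul_smul_comm, smul_mul_assoc, smul_sub, smul_comm c])
    (fun a b b' => by
      simp only [superBracket, ← Finset.sum_add_distrib]
      refine Finset.sum_congr rfl fun s _ => Finset.sum_congr rfl fun t _ => ?_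
      rw [show parityComponent 𝒱 t (b + b') = parityComponent 𝒱 t b + parityComponent 𝒱 t b' from
        map_add (parityComponentHom 𝒱 t) b b']
      simp only [mul_add, add_mul, smul_add]; abel)
    (fun c a b => by
      simp only [superBracket, Finset.smul_sum]
      refine Finset.sum_congr rfl fun s _ => Finset.sum_congr rfl fun t _ => ?_
      rw [show parityComponent 𝒱 t (c • b) = c • parityComponent 𝒱 t b from
        map_smul (parityComponentHom 𝒱 t) c b]
      simp only [mul_smul_comm, smul_mul_assoc, smul_sub, smul_comm c])

theorem superBracketHom_apply (a b : Module.End K V) :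
    superBracketHom 𝒱 a b = superBracket 𝒱 a b := rfl

theorem superBracket_of_mem {s t : ZMod 2} {a b : Module.End K V} (ha : a ∈ endPart 𝒱 s)
    (hb : b ∈ endPart 𝒱 t) :
    superBracket 𝒱 a b = a * b - (-1 : K) ^ (s.val * t.val) • (b * a) := by
  rw [superBracket, Finset.sum_eq_single s, Finset.sum_eq_single t, parityComponent_of_mem 𝒱 ha,
    parityComponent_of_mem 𝒱 hb]
  · intro u _ hu
    rw [parityComponent_of_mem_ne 𝒱 hb hu.symm]; simp
  · simp
  · intro u _ hu
    rw [parityComponent_of_mem_ne 𝒱 ha hu.symm]; simp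
  · simp

theorem superBracket_odd {a b : Module.End K V} (ha : a ∈ endPart 𝒱 1)
    (hb : b ∈ endPart 𝒱 1) : superBracket 𝒱 a b = a * b + b * a := by
  rw [superBracket_of_mem 𝒱 ha hb]
  simp [ZMod.val_one]

theorem superBracket_swap {s t : ZMod 2} {a b : Module.End K V} (ha : a ∈ endPart 𝒱 s)
    (hb : b ∈ endPart 𝒱 t) :
    superBracket 𝒱 b a = -(-1 : K) ^ (s.val * t.val) • superBracket 𝒱 a b := by
  have h : (-1 : K) ^ (s.val * t.val) * (-1 : K) ^ (s.val * t.val) = 1 := by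
    rw [← mul_pow]; simp
  rw [superBracket_of_mem 𝒱 ha hb, superBracket_of_mem 𝒱 hb ha, mul_comm t.val, smul_sub, smul_smul,
    neg_mul, h]
  simp only [neg_smul, one_smul]
  abel

theorem superBracket_mem_span {s t : Set (Module.End K V)} {W : Submodule K (Module.End K V)}
    (h : ∀ a ∈ s, ∀ b ∈ t, superBracket 𝒱 a b ∈ W) {a b : Module.End K V}
    (ha : a ∈ Submodule.span K s) (hb : b ∈ Submodule.span K t) : superBracket 𝒱 a b ∈ W := by
  have h' : Submodule.map₂ (superBracketHom 𝒱) (Submodule.span K s) (Submodule.span K t) ≤ W := by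
    rw [Submodule.map₂_span_span, Submodule.span_le]
    rintro _ ⟨a, ha, b, hb, rfl⟩
    exact h a ha b hb
  exact h' (Submodule.apply_mem_map₂ _ ha hb)

theorem isGraded_span {X : Set (Module.End K V)} (hX : ∀ a ∈ X, ∃ s, a ∈ endPart 𝒱 s) :
    IsGraded 𝒱 (Submodule.span K X) := by
  intro s a ha
  suffices h : Submodule.span K X ≤ (Submodule.span K X).comap (parityComponentHom 𝒱 s) from h ha
  rw [Submodule.span_le]
  intro b hb
  change parityComponent 𝒱 s b ∈ Submodule.span K X
  obtain ⟨t, ht⟩ := hX b hb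
  by_cases h : t = s
  · subst h
    rw [parityComponent_of_mem 𝒱 ht]; exact Submodule.subset_span hb
  · rw [parityComponent_of_mem_ne 𝒱 ht h]; exact zero_mem _

/-- An odd element of a span of homogeneous elements has its square in `W` if the squares and the
brackets of the odd generators are in `W`. -/
theorem square_mem_of_span {X : Set (Module.End K V)} {W : Submodule K (Module.End K V)}
    (hX : ∀ a ∈ X, ∃ s, a ∈ endPart 𝒱 s)
    (hb : ∀ a ∈ X, ∀ b ∈ X, superBracket 𝒱 a b ∈ W)
    (hs : ∀ a ∈ X, a ∈ endPart 𝒱 1 → a * a ∈ W) {a : Module.End K V}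
    (ha : a ∈ Submodule.span K X) (hodd : a ∈ endPart 𝒱 1) : a * a ∈ W := by
  -- The induction runs over arbitrary elements of the span and squares their odd components,
  -- because the summands of an odd element need not be odd. The addition step is
  -- $(x+y)^2=x^2+y^2+[x,y]$.
  have key : ∀ b ∈ Submodule.span K X,
      parityComponent 𝒱 1 b ∈ Submodule.span K X ∧
        parityComponent 𝒱 1 b * parityComponent 𝒱 1 b ∈ W := by
    intro b hb'
    refine ⟨isGraded_span 𝒱 hX 1 b hb', ?_⟩
    induction hb' using Submodule.span_induction with
    | mem b hb' =>
      obtain ⟨t, ht⟩ := hX b hb'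
      by_cases h : t = 1
      · subst h
        rw [parityComponent_of_mem 𝒱 ht]; exact hs b hb' ht
      · rw [parityComponent_of_mem_ne 𝒱 ht h]; simp
    | zero =>
      rw [show parityComponent 𝒱 1 0 = 0 from map_zero (parityComponentHom 𝒱 1)]; simp
    | add x y hx hy hx' hy' =>
      rw [show parityComponent 𝒱 1 (x + y) = parityComponent 𝒱 1 x + parityComponent 𝒱 1 y from
        map_add (parityComponentHom 𝒱 1) x y]
      have h1 := superBracket_mem_span 𝒱 hb (isGraded_span 𝒱 hX 1 x hx)
        (isGraded_span 𝒱 hX 1 y hy)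
      rw [superBracket_odd 𝒱 (parityComponent_mem 𝒱 1 x) (parityComponent_mem 𝒱 1 y)] at h1
      have := W.add_mem (W.add_mem hx' hy') h1
      convert this using 1
      noncomm_ring
    | smul c x hx hx' =>
      rw [show parityComponent 𝒱 1 (c • x) = c • parityComponent 𝒱 1 x from
        map_smul (parityComponentHom 𝒱 1) c x, smul_mul_smul_comm]
      exact W.smul_mem _ hx'
  have := (key a ha).2
  rwa [parityComponent_of_mem 𝒱 hodd] at this

theorem isLieSubsuperalgebra_lieGenerated (X : Set (Module.End K V)) :
    IsLieSubsuperalgebra 𝒱 (lieGenerated 𝒱 X) where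
  graded s a ha := by
    simp only [lieGenerated, Submodule.mem_sInf] at ha ⊢
    exact fun L hL => hL.1.graded s a (ha L hL)
  bracket_mem a ha b hb := by
    simp only [lieGenerated, Submodule.mem_sInf] at ha hb ⊢
    exact fun L hL => hL.1.bracket_mem a (ha L hL) b (hb L hL)
  square_mem a ha h := by
    simp only [lieGenerated, Submodule.mem_sInf] at ha ⊢
    exact fun L hL => hL.1.square_mem a (ha L hL) h

theorem subset_lieGenerated (X : Set (Module.End K V)) : X ⊆ lieGenerated 𝒱 X := by
  intro a ha
  simp only [lieGenerated, SetLike.mem_coe, Submodule.mem_sInf]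
  exact fun L hL => hL.2 ha

theorem finiteCodimIn_of_span {I L : Submodule K (Module.End K V)} {X : Set (Module.End K V)}
    (hX : X.Finite) (hXL : X ⊆ L) (h : L ≤ Submodule.span K X ⊔ I) : FiniteCodimIn I L := by
  set π := (I.submoduleOf L).mkQ
  have hfin : (π '' ((↑) ⁻¹' X : Set L)).Finite :=
    (hX.preimage Subtype.val_injective.injOn).image _
  refine ⟨(Submodule.fg_def.2 ⟨_, hfin, ?_⟩)⟩
  rw [← Submodule.map_span, eq_top_iff]
  rintro y -
  obtain ⟨⟨x, hx⟩, rfl⟩ := Submodule.mkQ_surjective _ y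
  obtain ⟨u, hu, v, hv, huv⟩ := Submodule.mem_sup.1 (h hx)
  have huL : u ∈ L := (Submodule.span_le.2 hXL) hu
  refine ⟨⟨u, huL⟩, ?_, ?_⟩
  · rw [SetLike.mem_coe]
    have : Submodule.map L.subtype (Submodule.span K ((↑) ⁻¹' X : Set L)) = Submodule.span K X := by
      rw [Submodule.map_span]
      congr 1
      ext z
      simp only [Submodule.coe_subtype, Set.mem_image, Set.mem_preimage]
      exact ⟨by rintro ⟨w, hw, rfl⟩; exact hw, fun hz => ⟨⟨z, hXL hz⟩, hz, rfl⟩⟩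
    rw [← this] at hu
    obtain ⟨w, hw, hwu⟩ := hu
    have hw' : w = ⟨u, huL⟩ := Subtype.ext hwu
    rwa [hw'] at hw
  · rw [← sub_eq_zero, ← map_sub]
    rw [Submodule.mkQ_apply, Submodule.Quotient.mk_eq_zero, Submodule.submoduleOf,
      Submodule.mem_comap]
    simp only [Submodule.subtype_apply, AddSubgroupClass.coe_sub]
    rw [← huv, sub_add_cancel_left]
    exact I.neg_mem hv

/-- Since $\varphi$ factors through the quotient by $I$, its coordinates are functionals there dual
to the classes of the $v_n$, $n\ge m$. These infinitely many classes are therefore independent. -/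
theorem not_finiteCodimIn_of_dual (φ : Module.End K V →ₗ[K] (ℕ → K)) {v : ℕ → Module.End K V}
    (hv : ∀ n j, φ (v n) j = if n = j then 1 else 0) {I L : Submodule K (Module.End K V)} {m : ℕ}
    (hI : I ≤ LinearMap.ker φ) (hL : ∀ n, m ≤ n → v n ∈ L) : ¬ FiniteCodimIn I L := by
  intro hfin
  have : FiniteDimensional K (L ⧸ I.submoduleOf L) := hfin
  let ψ : (L ⧸ I.submoduleOf L) →ₗ[K] (ℕ → K) :=
    (I.submoduleOf L).liftQ (φ ∘ₗ L.subtype) fun x hx => hI hx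
  let w : ℕ → L ⧸ I.submoduleOf L := fun n => (I.submoduleOf L).mkQ ⟨v (m + n), hL _ (by omega)⟩
  have hw : ∀ n j, ψ (w n) j = if m + n = j then 1 else 0 := fun n j => hv (m + n) j
  have hli : LinearIndependent K w := by
    rw [linearIndependent_iff']
    intro s g hg i hi
    have h := congrFun (congrArg ψ hg) (m + i)
    rw [map_sum, Finset.sum_apply] at h
    simp only [map_smul, Pi.smul_apply, hw, map_zero, Pi.zero_apply, smul_eq_mul] at h
    rw [Finset.sum_eq_single i (fun j _ hj => by rw [if_neg (by omega), mul_zero])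
      (fun h' => absurd hi h'), if_pos rfl, mul_one] at h
    exact h
  exact not_finite_iff_infinite.2 inferInstance hli.finite

theorem finiteCodimIn_of_finiteDimensional {I L : Submodule K (Module.End K V)}
    (h : FiniteDimensional K L) : FiniteCodimIn I L :=
  inferInstanceAs (FiniteDimensional K (L ⧸ I.submoduleOf L))

theorem mul_eq_zero_of_mem_span {X : Set (Module.End K V)} (h : ∀ a ∈ X, ∀ b ∈ X, a * b = 0)
    {a b : Module.End K V} (ha : a ∈ Submodule.span K X) (hb : b ∈ Submodule.span K X) :
    a * b = 0 := by
  have h' : Submodule.map₂ (LinearMap.mul K (Module.End K V)) (Submodule.span K X)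
      (Submodule.span K X) ≤ ⊥ := by
    rw [Submodule.map₂_span_span, Submodule.span_le]
    rintro _ ⟨a, ha, b, hb, rfl⟩
    exact h a ha b hb
  exact (Submodule.mem_bot K).1 (h' (Submodule.apply_mem_map₂ _ ha hb))

theorem smul_sub_smul_mem {W : Submodule K (Module.End K V)} (c : K) {a b : Module.End K V}
    (h : a - b ∈ W) : c • a - c • b ∈ W := by
  rw [← smul_sub]; exact W.smul_mem c h

theorem FiniteCodimIn.mono {I J L : Submodule K (Module.End K V)} (h : I ≤ J)
    (hI : FiniteCodimIn I L) : FiniteCodimIn J L := by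
  have hle : I.submoduleOf L ≤ J.submoduleOf L := Submodule.comap_mono h
  have : FiniteDimensional K (L ⧸ I.submoduleOf L) := hI
  exact Module.Finite.of_surjective _ (Submodule.factor_surjective hle)

end General

/-! ### Equality up to sign -/

section

/-- Equality up to sign. -/
def SignEq {M : Type*} [Neg M] (a b : M) : Prop := a = b ∨ a = -b

namespace SignEq

theorem refl {M : Type*} [Neg M] (a : M) : SignEq a a := Or.inl rfl

theorem symm {M : Type*} [InvolutiveNeg M] {a b : M} (h : SignEq a b) : SignEq b a := by
  rcases h with rfl | rfl
  · exact refl _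
  · right; simp

theorem trans {M : Type*} [InvolutiveNeg M] {a b c : M} (h : SignEq a b) (h' : SignEq b c) :
    SignEq a c := by
  rcases h with rfl | rfl
  · exact h'
  · rcases h' with rfl | rfl
    · right; simp
    · left; simp

theorem mul {R : Type*} [Ring R] {a b c d : R} (h : SignEq a b) (h' : SignEq c d) :
    SignEq (a * c) (b * d) := by
  rcases h with rfl | rfl <;> rcases h' with rfl | rfl
  · exact refl _
  · right; simp
  · right; simp
  · left; simp

theorem map {M N F : Type*} [AddGroup M] [AddGroup N] [FunLike F M N] [AddMonoidHomClass F M N]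
    (φ : F) {a b : M} (h : SignEq a b) : SignEq (φ a) (φ b) := by
  rcases h with rfl | rfl
  · exact refl _
  · right; simp

theorem eq_zero {M : Type*} [AddGroup M] {a : M} (h : SignEq a 0) : a = 0 := by
  rcases h with rfl | rfl <;> simp

theorem mem_iff {R M : Type*} [Ring R] [AddCommGroup M] [Module R M] (W : Submodule R M) {a b : M}
    (h : SignEq a b) : a ∈ W ↔ b ∈ W := by
  rcases h with rfl | rfl
  · rfl
  · simp

theorem exists_smul (K : Type*) {M : Type*} [Field K] [AddCommGroup M] [Module K M] {a b : M}
    (h : SignEq a b) : ∃ c : K, (c = 1 ∨ c = -1) ∧ a = c • b := by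
  rcases h with rfl | rfl
  · exact ⟨1, Or.inl rfl, by simp⟩
  · exact ⟨-1, Or.inr rfl, by simp⟩

end SignEq

/-! ### Monomials of the Grassmann algebra -/

variable (K : Type*) [Field K]

/-- The Grassmann monomial `x_S`. -/
def gMonomial (S : Finset ℕ) : Grassmann K := ((S.sort (· ≤ ·)).map (letter K)).prod

theorem monomialOp_eq (S : Finset ℕ) (n : ℕ) :
    monomialOp K S n = LinearMap.mulLeft K (gMonomial K S) * pivot K n := rfl

theorem gMonomial_empty : gMonomial K ∅ = 1 := by simp [gMonomial]

theorem monomialOp_empty (n : ℕ) : monomialOp K ∅ n = pivot K n := by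
  rw [monomialOp_eq, gMonomial_empty]; ext f; simp

theorem letter_mul_self (i : ℕ) : letter K i * letter K i = 0 := by
  rw [letter, ExteriorAlgebra.ι_sq_zero]

theorem letter_mul_letter (i j : ℕ) : letter K i * letter K j = -(letter K j * letter K i) := by
  rw [eq_neg_iff_add_eq_zero]
  exact ExteriorAlgebra.ι_add_mul_swap _ _

theorem signEq_prod_of_perm {l l' : List ℕ} (h : l.Perm l') :
    SignEq (l.map (letter K)).prod (l'.map (letter K)).prod := by
  induction h with
  | nil => exact SignEq.refl _
  | cons x _ ih => simpa using (SignEq.refl (letter K x)).mul ih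
  | swap x y l =>
    right
    simp only [List.map_cons, List.prod_cons, ← mul_assoc]
    rw [letter_mul_letter K y x, neg_mul]
  | trans _ _ ih ih' => exact ih.trans ih'

theorem signEq_prod_toFinset {l : List ℕ} (h : l.Nodup) :
    SignEq (l.map (letter K)).prod (gMonomial K l.toFinset) :=
  signEq_prod_of_perm K (by
    rw [← Multiset.coe_eq_coe, Finset.sort_eq, List.toFinset_val, List.dedup_eq_self.2 h])

theorem letter_mul_gMonomial {i : ℕ} {S : Finset ℕ} (h : i ∉ S) :
    SignEq (letter K i * gMonomial K S) (gMonomial K (insert i S)) := by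
  have := signEq_prod_toFinset K (l := i :: S.sort (· ≤ ·)) (by simp [h])
  simpa [gMonomial] using this

theorem signEq_gMonomial_of_mem {i : ℕ} {S : Finset ℕ} (h : i ∈ S) :
    SignEq (gMonomial K S) (letter K i * gMonomial K (S.erase i)) := by
  have := letter_mul_gMonomial K (Finset.notMem_erase i S)
  rw [Finset.insert_erase h] at this
  exact this.symm

theorem letter_mul_gMonomial_of_mem {i : ℕ} {S : Finset ℕ} (h : i ∈ S) :
    letter K i * gMonomial K S = 0 := by
  refine (((SignEq.refl (letter K i)).mul (signEq_gMonomial_of_mem K h)).trans ?_).eq_zero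
  rw [← mul_assoc, letter_mul_self, zero_mul]
  exact SignEq.refl _

theorem gMonomial_mul_of_disjoint {S T : Finset ℕ} (h : Disjoint S T) :
    SignEq (gMonomial K S * gMonomial K T) (gMonomial K (S ∪ T)) := by
  have := signEq_prod_toFinset K (l := S.sort (· ≤ ·) ++ T.sort (· ≤ ·)) (by
    rw [List.nodup_append']
    refine ⟨Finset.sort_nodup _ _, Finset.sort_nodup _ _, fun a ha hb => ?_⟩
    exact Finset.disjoint_left.1 h ((Finset.mem_sort _).1 ha) ((Finset.mem_sort _).1 hb))
  simpa [gMonomial] using this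

theorem gMonomial_mul_of_mem {S T : Finset ℕ} {i : ℕ} (hS : i ∈ S) (hT : i ∈ T) :
    gMonomial K S * gMonomial K T = 0 := by
  have h1 := (signEq_prod_of_perm K (l := S.sort (· ≤ ·)) (l' := (S.erase i).sort (· ≤ ·) ++ [i]) (by
    rw [← Multiset.coe_eq_coe, Finset.sort_eq, ← Multiset.coe_add, Finset.sort_eq]
    rw [Finset.erase_val, add_comm, Multiset.coe_singleton, Multiset.singleton_add,
      Multiset.cons_erase (Finset.mem_def.1 hS)]))
  simp only [List.map_append, List.prod_append, List.map_cons, List.map_nil, List.prod_singleton]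
    at h1
  refine ((h1.mul (signEq_gMonomial_of_mem K hT)).trans ?_).eq_zero
  rw [mul_assoc, ← mul_assoc (letter K i), letter_mul_self]
  simpa using SignEq.refl _

/-- `x_S x_T` is `± x_{S ∪ T}` or zero. -/
theorem gMonomial_mul (S T : Finset ℕ) :
    Disjoint S T ∧ SignEq (gMonomial K S * gMonomial K T) (gMonomial K (S ∪ T)) ∨
      ¬ Disjoint S T ∧ gMonomial K S * gMonomial K T = 0 := by
  by_cases h : Disjoint S T
  · exact Or.inl ⟨h, gMonomial_mul_of_disjoint K h⟩
  · refine Or.inr ⟨h, ?_⟩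
    obtain ⟨i, hS, hT⟩ := Finset.not_disjoint_iff.1 h
    exact gMonomial_mul_of_mem K hS hT

theorem letter_mem (i : ℕ) : letter K i ∈ grassmannPart K 1 :=
  CliffordAlgebra.ι_mem_evenOdd_one _ _

theorem gMonomial_mem (S : Finset ℕ) : gMonomial K S ∈ grassmannPart K (S.card : ZMod 2) := by
  have h : ∀ l : List ℕ, (l.map (letter K)).prod ∈ grassmannPart K (l.length : ZMod 2) := by
    intro l
    induction l with
    | nil => simpa using SetLike.GradedOne.one_mem (A := grassmannPart K)
    | cons i l ih =>
      rw [List.map_cons, List.prod_cons, List.length_cons, Nat.cast_succ, add_comm]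
      exact SetLike.mul_mem_graded (letter_mem K i) ih
  simpa [gMonomial] using h (S.sort (· ≤ ·))

/-- The grading automorphism of the Grassmann algebra. -/
abbrev inv (f : Grassmann K) : Grassmann K := CliffordAlgebra.involute f

theorem inv_letter (i : ℕ) : inv K (letter K i) = -letter K i :=
  CliffordAlgebra.involute_ι _

theorem inv_gMonomial (S : Finset ℕ) :
    inv K (gMonomial K S) = (-1 : K) ^ S.card • gMonomial K S := by
  have := CliffordAlgebra.involute_prod_map_ι (Q := (0 : QuadraticForm K (ℕ →₀ K)))
    ((S.sort (· ≤ ·)).map fun i => Finsupp.single i 1)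
  rw [List.map_map, List.length_map, Finset.length_sort] at this
  exact this

/-! ### Superderivatives -/

theorem partialD_letter_mul (i j : ℕ) (f : Grassmann K) :
    partialD K i (letter K j * f) = (if i = j then f else 0) - letter K j * partialD K i f := by
  rw [partialD, letter]
  refine (CliffordAlgebra.contractLeft_ι_mul _ _ _).trans ?_
  congr 1
  rw [Finsupp.lapply_apply, Finsupp.single_apply]
  by_cases h : i = j
  · simp [h]
  · rw [if_neg (Ne.symm h), if_neg h, zero_smul]

theorem partialD_one (i : ℕ) : partialD K i 1 = 0 :=
  CliffordAlgebra.contractLeft_one (Q := (0 : QuadraticForm K (ℕ →₀ K))) (Finsupp.lapply i)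

theorem partialD_letter (i j : ℕ) :
    partialD K i (letter K j) = if i = j then 1 else 0 := by
  have := partialD_letter_mul K i j 1
  rw [mul_one] at this
  rw [this, partialD_one, mul_zero, sub_zero]

theorem partialD_mul (i : ℕ) (f g : Grassmann K) :
    partialD K i (f * g) = partialD K i f * g + inv K f * partialD K i g := by
  induction f using CliffordAlgebra.left_induction with
  | algebraMap r =>
    rw [partialD, CliffordAlgebra.contractLeft_algebraMap_mul, CliffordAlgebra.contractLeft_algebraMap,
      inv, AlgHom.commutes, zero_mul, zero_add]
  | add x y hx hy => 
    have h : inv K (x + y) = inv K x + inv K y := map_add _ _ _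
    rw [add_mul, map_add, hx, hy, map_add, h]; noncomm_ring
  | ι_mul x m hx =>
    rw [mul_assoc]
    have h1 := CliffordAlgebra.contractLeft_ι_mul (Q := (0 : QuadraticForm K (ℕ →₀ K)))
      (d := Finsupp.lapply i) m (x * g)
    have h2 := CliffordAlgebra.contractLeft_ι_mul (Q := (0 : QuadraticForm K (ℕ →₀ K)))
      (d := Finsupp.lapply i) m x
    unfold partialD at hx ⊢
    rw [h1, h2, hx, inv, inv, map_mul, CliffordAlgebra.involute_ι]
    simp only [sub_mul, smul_mul_assoc]
    noncomm_ring

theorem partialD_partialD (i j : ℕ) (f : Grassmann K) :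
    partialD K i (partialD K j f) = -partialD K j (partialD K i f) :=
  CliffordAlgebra.contractLeft_comm _ _ _

theorem partialD_self (i : ℕ) (f : Grassmann K) : partialD K i (partialD K i f) = 0 :=
  CliffordAlgebra.contractLeft_contractLeft _ _

theorem partialD_gMonomial_of_notMem {i : ℕ} {S : Finset ℕ} (h : i ∉ S) :
    partialD K i (gMonomial K S) = 0 := by
  have h' : ∀ l : List ℕ, i ∉ l → partialD K i (l.map (letter K)).prod = 0 := by
    intro l hl
    induction l with
    | nil => simpa using partialD_one K i
    | cons j l ih =>
      rw [List.mem_cons, not_or] at hl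
      rw [List.map_cons, List.prod_cons, partialD_letter_mul, if_neg hl.1, ih hl.2]
      simp
  exact h' _ (by simpa using h)

theorem partialD_gMonomial_of_mem {i : ℕ} {S : Finset ℕ} (h : i ∈ S) :
    SignEq (partialD K i (gMonomial K S)) (gMonomial K (S.erase i)) := by
  refine ((signEq_gMonomial_of_mem K h).map (partialD K i)).trans ?_
  rw [partialD_letter_mul, if_pos rfl, partialD_gMonomial_of_notMem K (Finset.notMem_erase i S)]
  left; simp

/-! ### Pivot elements -/

variable {K}

theorem pivot_eq_zero {i : ℕ} {f : Grassmann K} (h : ∀ n, i ≤ n → partialD K n f = 0) :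
    pivot K i f = 0 := by
  change ∑ᶠ k : ℕ, _ = _
  rw [finsum_eq_zero_of_forall_eq_zero]
  intro k
  rw [h _ (by omega), mul_zero]

theorem pivot_rec (i : ℕ) (f : Grassmann K) :
    pivot K i f = partialD K i f + letter K i * (letter K (i + 1) * pivot K (i + 3) f) := by
  obtain ⟨N, hN⟩ := eventually_partialD_eq_zero K f
  have h : ∀ i M, N ≤ M →
      pivot K i f = ∑ k ∈ Finset.range M, pivotCoeff K i k * partialD K (i + 3 * k) f := by
    intro i M hM
    refine finsum_eq_sum_of_support_subset _ fun k hk => ?_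
    by_contra hk'
    refine hk ?_
    simp only [Finset.coe_range, Set.mem_Iio, not_lt] at hk'
    simp only [hN _ (show N ≤ i + 3 * k by omega), mul_zero]
  rw [h i (N + 1) (by omega), h (i + 3) N le_rfl, Finset.sum_range_succ']
  simp only [pivotCoeff, mul_zero, add_zero, one_mul, Finset.mul_sum]
  rw [add_comm]
  congr 1
  refine Finset.sum_congr rfl fun k _ => ?_
  rw [show i + 3 * (k + 1) = i + 3 + 3 * k by ring]
  simp only [mul_assoc]

/-- Replaces the infinite sum by its recursion: $v_i$ is expressed through $v_{i+3}$, and on a fixed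
element all $v_n$ with $n$ large vanish, so descending induction in steps of three applies. -/
theorem pivot_induction {P : ℕ → Prop} (h : ∃ N, ∀ n, N ≤ n → P n) (hs : ∀ i, P (i + 3) → P i)
    (i : ℕ) : P i := by
  obtain ⟨N, hN⟩ := h
  have : ∀ k i, N ≤ i + 3 * k → P i := by
    intro k
    induction k with
    | zero => exact fun i hi => hN i hi
    | succ k ih => exact fun i hi => hs i (ih (i + 3) (by omega))
  exact this N i (by omega)

/-- A pivot is an odd superderivation: the factor $x_ix_{i+1}$ is even, hence central, and the
recursion carries the Leibniz rule from $v_{i+3}$ to $v_i$. -/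
theorem pivot_mul (i : ℕ) (f g : Grassmann K) :
    pivot K i (f * g) = pivot K i f * g + inv K f * pivot K i g := by
  have hcomm : ∀ i j, ∀ f : Grassmann K, letter K i * (letter K j * f) = f * (letter K i * letter K j) := by
    intro i j f
    induction f using CliffordAlgebra.left_induction with
    | algebraMap r => rw [← mul_assoc, Algebra.commutes]
    | add x y hx hy => rw [mul_add, mul_add, add_mul, hx, hy]
    | ι_mul x m hx =>
      have hsw : ∀ i, letter K i * CliffordAlgebra.ι (0 : QuadraticForm K (ℕ →₀ K)) m
          = -(CliffordAlgebra.ι (0 : QuadraticForm K (ℕ →₀ K)) m * letter K i) := by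
        intro i
        rw [eq_neg_iff_add_eq_zero]
        exact ExteriorAlgebra.ι_add_mul_swap _ _
      rw [← mul_assoc (letter K j), hsw, neg_mul, mul_neg, ← mul_assoc (letter K i),
        ← mul_assoc (letter K i), hsw, mul_assoc _ x, ← hx]
      simp only [neg_mul, neg_neg, mul_assoc]
  obtain ⟨N, hN⟩ := eventually_partialD_eq_zero K f
  obtain ⟨M, hM⟩ := eventually_partialD_eq_zero K g
  refine pivot_induction (P := fun i => pivot K i (f * g) = pivot K i f * g + inv K f * pivot K i g)
    ⟨max N M, fun n hn => ?_⟩ (fun i hi => ?_) i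
  · have h1 : ∀ k, n ≤ k → partialD K k f = 0 := fun k hk => hN k (by omega)
    have h2 : ∀ k, n ≤ k → partialD K k g = 0 := fun k hk => hM k (by omega)
    rw [pivot_eq_zero h1, pivot_eq_zero h2, pivot_eq_zero fun k hk => by
      rw [partialD_mul, h1 k hk, h2 k hk]; simp]
    simp
  · rw [pivot_rec, hi, pivot_rec i f, pivot_rec i g, partialD_mul]
    have h2 := hcomm i (i + 1) (inv K f)
    simp only [mul_add, add_mul, mul_assoc]
    rw [← mul_assoc (letter K (i + 1)) (inv K f), ← mul_assoc (letter K i) _ (pivot K (i + 3) g), h2]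
    simp only [mul_assoc]
    abel

theorem pivot_letter_of_lt {i j : ℕ} (h : j < i) : pivot K i (letter K j) = 0 :=
  pivot_eq_zero fun n hn => by rw [partialD_letter, if_neg (by omega)]

theorem pivot_letter_self (i : ℕ) : pivot K i (letter K i) = 1 := by
  rw [pivot_rec, pivot_letter_of_lt (by omega), partialD_letter]; simp

theorem pivot_letter_mul (i j : ℕ) (f : Grassmann K) :
    pivot K i (letter K j * f) = pivot K i (letter K j) * f - letter K j * pivot K i f := by
  rw [pivot_mul, inv_letter, neg_mul, sub_eq_add_neg]

theorem pivot_letter_mul_of_lt {i j : ℕ} (h : j < i) (f : Grassmann K) :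
    pivot K i (letter K j * f) = -(letter K j * pivot K i f) := by
  rw [pivot_letter_mul, pivot_letter_of_lt h, zero_mul, zero_sub]

theorem pivot_letter_mul_self (i : ℕ) (f : Grassmann K) :
    pivot K i (letter K i * f) = f - letter K i * pivot K i f := by
  rw [pivot_letter_mul, pivot_letter_self, one_mul]

/-- The coefficients of $v_m$ involve only letters of index at least $m$, so $\partial_j$ passes
through them. -/
theorem pivot_partialD {j m : ℕ} (h : j < m) (f : Grassmann K) :
    pivot K m (partialD K j f) = -partialD K j (pivot K m f) := by
  obtain ⟨N, hN⟩ := eventually_partialD_eq_zero K f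
  refine pivot_induction (P := fun m => j < m → pivot K m (partialD K j f) =
    -partialD K j (pivot K m f)) ⟨N, fun n hn _ => ?_⟩ (fun m hm h => ?_) m h
  · rw [pivot_eq_zero fun k hk => hN k (by omega), pivot_eq_zero fun k hk => by
      rw [partialD_partialD, hN k (by omega)]; simp]
    simp
  · rw [pivot_rec, hm (by omega), pivot_rec m f, map_add, partialD_partialD, partialD_letter_mul,
      partialD_letter_mul, if_neg (by omega), if_neg (by omega)]
    simp only [zero_sub, mul_neg, neg_neg, neg_add]

theorem letter_mul_letter_mul_self (i : ℕ) (f : Grassmann K) :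
    letter K i * (letter K i * f) = 0 := by
  rw [← mul_assoc, letter_mul_self, zero_mul]

/-- `v_i² = x_{i+1} v_{i+3}`. -/
theorem pivot_pivot (i : ℕ) (f : Grassmann K) :
    pivot K i (pivot K i f) = letter K (i + 1) * pivot K (i + 3) f := by
  have h1 := pivot_rec i f
  -- Behind the factor $x_ix_{i+1}$ the operator $v_i$ reduces to $\partial_i$. This term then
  -- cancels against $v_i\partial_i f$, computed in `h4`.
  have h2 : letter K i * (letter K (i + 1) * pivot K i (pivot K (i + 3) f)) =
      letter K i * (letter K (i + 1) * partialD K i (pivot K (i + 3) f)) := by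
    rw [pivot_rec i (pivot K (i + 3) f), mul_add, mul_add, ← mul_assoc (letter K (i + 1)) (letter K i),
      letter_mul_letter K (i + 1) i]
    simp [mul_assoc, letter_mul_letter_mul_self]
  have h3 : pivot K i (letter K (i + 1)) = 0 := by
    rw [pivot_rec, pivot_letter_of_lt (by omega), partialD_letter]; simp
  have h4 : pivot K i (partialD K i f) =
      -(letter K i * (letter K (i + 1) * partialD K i (pivot K (i + 3) f))) := by
    rw [pivot_rec, partialD_self, pivot_partialD (by omega)]
    simp
  rw [h1, map_add, pivot_letter_mul_self, pivot_letter_mul i (i + 1), h3, h4, zero_mul, zero_sub,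
    mul_neg, h2]
  abel

/-- For $m\ge n+2$ the pivot $v_m$ annihilates $x_n$ and $x_{n+1}$ and anticommutes with
$\partial_n$, so only the tail of $v_n$ contributes. -/
theorem pivot_anticomm_step {n m : ℕ} (h : n + 2 ≤ m) (f : Grassmann K) :
    pivot K n (pivot K m f) + pivot K m (pivot K n f) =
      letter K n * (letter K (n + 1) *
        (pivot K (n + 3) (pivot K m f) + pivot K m (pivot K (n + 3) f))) := by
  rw [pivot_rec n f, pivot_rec n (pivot K m f), map_add, pivot_partialD (by omega),
    pivot_letter_mul_of_lt (by omega), pivot_letter_mul_of_lt (by omega)]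
  simp only [mul_add, mul_neg, neg_neg]
  abel

theorem pivot_anticomm_succ (n : ℕ) (f : Grassmann K) :
    pivot K n (pivot K (n + 1) f) + pivot K (n + 1) (pivot K n f) =
      -(letter K n * pivot K (n + 3) f) := by
  -- The leftover term is $x_nx_{n+1}[v_{n+1},v_{n+3}]$, and the inner bracket is itself a multiple
  -- of $x_{n+1}$.
  have h := congrArg (fun g => letter K n * (letter K (n + 1) * g))
    (pivot_anticomm_step (n := n + 1) (m := n + 3) le_rfl f)
  simp only [letter_mul_letter_mul_self, mul_zero] at h
  rw [pivot_rec n f, pivot_rec n (pivot K (n + 1) f), map_add, pivot_partialD (by omega),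
    pivot_letter_mul_of_lt (by omega), pivot_letter_mul_self]
  simp only [mul_sub, mul_add] at h ⊢
  rw [← sub_eq_zero]
  rw [← h]
  abel

theorem pivot_anticomm_two (n : ℕ) (f : Grassmann K) :
    pivot K n (pivot K (n + 2) f) + pivot K (n + 2) (pivot K n f) =
      -(letter K n * (letter K (n + 1) * (letter K (n + 2) * pivot K (n + 5) f))) := by
  rw [pivot_anticomm_step le_rfl, add_comm (pivot K (n + 3) _), pivot_anticomm_succ]
  simp only [mul_neg]

end

/-! ### The weight -/

/-- The weight of `v_n` (and minus the weight of `x_n`) with respect to the generator `v_0`. -/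
def wt : ℕ → ℕ
  | 0 => 1
  | 1 => 0
  | 2 => 0
  | n + 3 => 2 * wt n + wt (n + 1)

theorem wt_add_three (n : ℕ) : wt (n + 3) = 2 * wt n + wt (n + 1) := by rw [wt]

/-- The partial sums obey the recursion of `wt` without a correction term, because the initial
weights are 1, 0, 0. Linear inequalities between weights and partial sums thus propagate from three
consecutive cases. -/
theorem sum_wt_add_three (k : ℕ) : ∑ i ∈ Finset.range (k + 3), wt i =
    2 * ∑ i ∈ Finset.range k, wt i + ∑ i ∈ Finset.range (k + 1), wt i := by
  induction k with
  | zero => decide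
  | succ k ih =>
    rw [Finset.sum_range_succ _ (k + 3), ih, wt_add_three, Finset.sum_range_succ _ k,
      Finset.sum_range_succ _ (k + 1), Finset.sum_range_succ _ k]
    ring

/-- The weight of $x_0\cdots x_{n-1}v_{n+2}$, the largest monomial of the first shape, is
nonnegative. The excluded values correspond to the lengths 4 and 7. -/
theorem sum_wt_le {n : ℕ} (h2 : n ≠ 2) (h5 : n ≠ 5) :
    ∑ i ∈ Finset.range n, wt i ≤ wt (n + 2) := by
  have h : ∀ k, ∑ i ∈ Finset.range (k + 6), wt i ≤ wt (k + 8) := by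
    intro k
    induction k using Nat.strong_induction_on with
    | _ k ih =>
      match k, ih with
      | 0, _ => decide
      | 1, _ => decide
      | 2, _ => decide
      | k + 3, ih =>
        have h1 := ih k (by omega)
        have h2 := ih (k + 1) (by omega)
        rw [show k + 3 + 6 = (k + 6) + 3 by ring, show k + 3 + 8 = (k + 8) + 3 by ring,
          sum_wt_add_three, wt_add_three]
        rw [show k + 1 + 6 = k + 6 + 1 by ring, show k + 1 + 8 = k + 8 + 1 by ring] at h2
        omega
  by_cases hn : n < 6
  · interval_cases n <;> first | contradiction | decide
  · obtain ⟨k, rfl⟩ := Nat.exists_eq_add_of_le (not_lt.1 hn)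
    rw [show 6 + k = k + 6 by ring]
    exact h k

/-- The same for $x_0\cdots x_nx_{n+3}v_{n+5}$, the largest monomial of the second shape. The
excluded values correspond to the lengths 5, 7 and 10. -/
theorem wt_add_sum_wt_le {n : ℕ} (h0 : n ≠ 0) (h2 : n ≠ 2) (h5 : n ≠ 5) :
    wt (n + 3) + ∑ i ∈ Finset.range (n + 1), wt i ≤ wt (n + 5) := by
  have h : ∀ k, wt (k + 9) + ∑ i ∈ Finset.range (k + 7), wt i ≤ wt (k + 11) := by
    intro k
    induction k using Nat.strong_induction_on with
    | _ k ih =>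
      match k, ih with
      | 0, _ => decide
      | 1, _ => decide
      | 2, _ => decide
      | k + 3, ih =>
        have h1 := ih k (by omega)
        have h2 := ih (k + 1) (by omega)
        rw [show k + 3 + 7 = (k + 7) + 3 by ring, show k + 3 + 11 = (k + 11) + 3 by ring,
          show k + 3 + 9 = (k + 9) + 3 by ring, sum_wt_add_three, wt_add_three (k + 9),
          wt_add_three (k + 11)]
        rw [show k + 1 + 7 = k + 7 + 1 by ring, show k + 1 + 11 = k + 11 + 1 by ring,
          show k + 1 + 9 = k + 9 + 1 by ring] at h2
        omega
  by_cases hn : n < 6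
  · interval_cases n <;> first | contradiction | decide
  · obtain ⟨k, rfl⟩ := Nat.exists_eq_add_of_le (not_lt.1 hn)
    rw [show 6 + k + 3 = k + 9 by ring, show 6 + k + 1 = k + 7 by ring,
      show 6 + k + 5 = k + 11 by ring]
    exact h k

/-! ### Exceptional monomials as monomials of negative weight -/

/-- As `wt` is nonnegative, weights are tested on extremal sets: a maximal admissible `S` for
nonnegative weight, a minimal forbidden one, $\{0\}$ or $\{0,3\}$, for negative weight. -/
theorem isFirstType_iff (S : Finset ℕ) (n : ℕ) :
    IsFirstType S n ↔ (∀ i ∈ S, i + 3 ≤ n) ∧ ∑ i ∈ S, wt i ≤ wt n := by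
  refine and_congr_right fun h => ?_
  have hle : ∀ {A B : Finset ℕ}, A ⊆ B → ∑ i ∈ A, wt i ≤ ∑ i ∈ B, wt i := fun h =>
    Finset.sum_le_sum_of_subset h
  by_cases h4 : n = 4
  · subst h4
    refine ⟨fun h' => ?_, fun h' => ⟨fun h0 => ?_, by omega⟩⟩
    · refine (hle (B := {1}) fun i hi => ?_).trans (by decide)
      have := h i hi
      have : i ≠ 0 := fun h0 => h'.1 ⟨rfl, h0 ▸ hi⟩
      simp only [Finset.mem_singleton]; omega
    · have := (hle (Finset.singleton_subset_iff.2 h0.2)).trans h'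
      exact absurd this (by decide)
  by_cases h7 : n = 7
  · subst h7
    refine ⟨fun h' => ?_, fun h' => ⟨by omega, fun h0 => ?_⟩⟩
    · by_cases h0 : 0 ∈ S
      · refine (hle (B := {0, 1, 2, 4}) fun i hi => ?_).trans (by decide)
        have := h i hi
        have : i ≠ 3 := fun h3 => h'.2 ⟨rfl, h0, h3 ▸ hi⟩
        simp only [Finset.mem_singleton, Finset.mem_insert]; omega
      · refine (hle (B := {1, 2, 3, 4}) fun i hi => ?_).trans (by decide)
        have := h i hi
        have : i ≠ 0 := fun h3 => h0 (h3 ▸ hi)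
        simp only [Finset.mem_singleton, Finset.mem_insert]; omega
    · have := (hle (A := {0, 3}) (B := S) fun i hi => by
        simp only [Finset.mem_singleton, Finset.mem_insert] at hi
        rcases hi with rfl | rfl
        exacts [h0.2.1, h0.2.2]).trans h'
      exact absurd this (by decide)
  refine ⟨fun _ => ?_, fun _ => ⟨by omega, by omega⟩⟩
  by_cases h2 : n < 2
  · have : S = ∅ := Finset.eq_empty_of_forall_notMem fun i hi => by have := h i hi; omega
    subst this; simp
  · obtain ⟨k, rfl⟩ := Nat.exists_eq_add_of_le (not_lt.1 h2)
    rw [add_comm]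
    refine (hle (B := Finset.range k) fun i hi => ?_).trans (sum_wt_le (by omega) (by omega))
    have := h i hi
    rw [Finset.mem_range]; omega

theorem isSecondType_iff (S : Finset ℕ) (n : ℕ) :
    IsSecondType S n ↔ 3 ≤ n ∧ n - 2 ∈ S ∧ (∀ i ∈ S, i = n - 2 ∨ i + 5 ≤ n) ∧
      ∑ i ∈ S, wt i ≤ wt n := by
  refine and_congr_right fun h3 => and_congr_right fun hS => and_congr_right fun h => ?_
  have hle : ∀ {A B : Finset ℕ}, A ⊆ B → ∑ i ∈ A, wt i ≤ ∑ i ∈ B, wt i := fun h =>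
    Finset.sum_le_sum_of_subset h
  by_cases h5 : n = 5
  · subst h5
    refine ⟨fun h' => ?_, fun h' => ⟨fun h0 => ?_, by omega, by omega⟩⟩
    · refine (hle (B := {3}) fun i hi => ?_).trans (by decide)
      have := h i hi
      have : i ≠ 0 := fun h0 => h'.1 ⟨rfl, h0 ▸ hi⟩
      simp only [Finset.mem_singleton]; omega
    · have := (hle (A := {0, 3}) (B := S) fun i hi => by
        simp only [Finset.mem_singleton, Finset.mem_insert] at hi
        rcases hi with rfl | rfl
        exacts [h0.2, hS]).trans h'
      exact absurd this (by decide)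
  by_cases h7 : n = 7
  · subst h7
    refine ⟨fun h' => ?_, fun h' => ⟨by omega, fun h0 => ?_, by omega⟩⟩
    · refine (hle (B := {1, 2, 5}) fun i hi => ?_).trans (by decide)
      have := h i hi
      have : i ≠ 0 := fun h0 => h'.2.1 ⟨rfl, h0 ▸ hi⟩
      simp only [Finset.mem_singleton, Finset.mem_insert]; omega
    · have := (hle (A := {0, 5}) (B := S) fun i hi => by
        simp only [Finset.mem_singleton, Finset.mem_insert] at hi
        rcases hi with rfl | rfl
        exacts [h0.2, hS]).trans h'
      exact absurd this (by decide)
  by_cases h10 : n = 10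
  · subst h10
    refine ⟨fun h' => ?_, fun h' => ⟨by omega, by omega, fun h0 => ?_⟩⟩
    -- The full set of admissible letters has excess weight over $v_{10}$. Dropping any one of
    -- $x_0,x_3,x_5$ compensates for it.
    · have key : ∀ j, j ∉ S → S ⊆ ({0, 1, 2, 3, 4, 5, 8} : Finset ℕ).erase j := by
        intro j hj i hi
        have := h i hi
        have : i ≠ j := fun h3 => hj (h3 ▸ hi)
        simp only [Finset.mem_singleton, Finset.mem_insert, Finset.mem_erase]; omega
      have : 0 ∉ S ∨ 3 ∉ S ∨ 5 ∉ S := by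
        by_contra! hc
        exact h'.2.2 ⟨rfl, hc⟩
      rcases this with h0 | h0 | h0
      all_goals exact (hle (key _ h0)).trans (by decide)
    · have := (hle (A := {0, 3, 5, 8}) (B := S) fun i hi => by
        simp only [Finset.mem_singleton, Finset.mem_insert] at hi
        rcases hi with rfl | rfl | rfl | rfl
        exacts [h0.2.1, h0.2.2.1, h0.2.2.2, hS]).trans h'
      exact absurd this (by decide)
  refine ⟨fun _ => ?_, fun _ => ⟨by omega, by omega, by omega⟩⟩
  by_cases h2 : n < 5
  · have : S ⊆ {n - 2} := fun i hi => by
      have := h i hi; rw [Finset.mem_singleton]; omega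
    refine (hle this).trans ?_
    interval_cases n <;> decide
  · obtain ⟨k, rfl⟩ := Nat.exists_eq_add_of_le (not_lt.1 h2)
    rw [add_comm 5 k]
    refine (hle (B := insert (k + 3) (Finset.range (k + 1))) fun i hi => ?_).trans ?_
    · have := h i hi
      rw [Finset.mem_insert, Finset.mem_range]; omega
    · rw [Finset.sum_insert (by simp)]
      exact wt_add_sum_wt_le (by omega) (by omega) (by omega)

/-- The shape of a basis monomial, without the exceptions for small lengths. -/
def HasShape (K : Type*) [Field K] (S : Finset ℕ) (n : ℕ) : Prop :=
  (∀ i ∈ S, i + 3 ≤ n) ∨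
    3 ≤ n ∧ n - 2 ∈ S ∧ (∀ i ∈ S, i = n - 2 ∨ i + 5 ≤ n) ∧ ((2 : K) = 0 → S = {n - 2})

/-- The exceptions are exactly the monomials of negative weight. -/
theorem isBasisMonomial_iff (K : Type*) [Field K] (S : Finset ℕ) (n : ℕ) :
    IsBasisMonomial K S n ↔ HasShape K S n ∧ ∑ i ∈ S, wt i ≤ wt n := by
  rw [IsBasisMonomial, isFirstType_iff, isSecondType_iff, HasShape]
  by_cases h : (2 : K) = 0
  · simp only [h, ne_eq, not_true_eq_false, false_and, false_or, true_and, true_implies, or_and_right]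
    refine or_congr_right ⟨?_, fun h => ⟨h.1.1, h.1.2.2.2⟩⟩
    rintro ⟨h3, rfl⟩
    refine ⟨⟨h3, by simp, by simp, rfl⟩, ?_⟩
    obtain ⟨k, rfl⟩ := Nat.exists_eq_add_of_le h3
    rw [Finset.sum_singleton, show 3 + k - 2 = k + 1 by omega, add_comm 3, wt_add_three]
    omega
  · simp only [h, ne_eq, not_false_eq_true, true_and, false_and, or_false, false_implies, and_true,
      or_and_right, and_assoc]

theorem HasShape.add_two_le {K : Type*} [Field K] {S : Finset ℕ} {n : ℕ} (h : HasShape K S n) {i : ℕ}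
    (hi : i ∈ S) : i + 2 ≤ n := by
  rcases h with h | ⟨h3, -, h, -⟩
  · have := h i hi; omega
  · have := h i hi; omega

/-! ### Action of pivot elements on monomials -/

section

variable {K : Type*} [Field K]

theorem pivot_gMonomial_of_lt {n : ℕ} {T : Finset ℕ} (h : ∀ i ∈ T, i < n) :
    pivot K n (gMonomial K T) = 0 :=
  pivot_eq_zero fun m hm => partialD_gMonomial_of_notMem K fun hT => by have := h m hT; omega

theorem pivot_gMonomial_of_mem {n : ℕ} {T : Finset ℕ} (h : n ∈ T) :
    SignEq (pivot K n (gMonomial K T)) (gMonomial K (T.erase n)) := by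
  -- The tail of $v_n$ is a multiple of $x_n$, and $x_n$ survives in $v_{n+3}(x_T)$.
  have h0 : letter K n * (letter K (n + 1) * pivot K (n + 3) (gMonomial K T)) = 0 := by
    have := ((signEq_gMonomial_of_mem K h).map (pivot K (n + 3)))
    rw [pivot_letter_mul_of_lt (by omega)] at this
    refine ((((SignEq.refl (letter K n)).mul ((SignEq.refl (letter K (n + 1))).mul this))).trans
      ?_).eq_zero
    left
    rw [mul_neg, ← mul_assoc (letter K (n + 1)), letter_mul_letter K (n + 1)]
    simp [mul_assoc, letter_mul_letter_mul_self]
  rw [pivot_rec, h0, add_zero]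
  exact partialD_gMonomial_of_mem K h

/-- The monomials occurring in `v_n(x_T)`. -/
theorem pivot_gMonomial_mem (T : Finset ℕ) (n : ℕ) :
    pivot K n (gMonomial K T) ∈ Submodule.span K {f | ∃ (j : ℕ) (C : Finset ℕ), j ∈ T ∧ n ≤ j ∧
      Disjoint C (T.erase j) ∧ (∀ i ∈ C, n ≤ i ∧ i + 2 ≤ j) ∧ ∑ i ∈ C, wt i + wt n = wt j ∧
      f = gMonomial K (C ∪ T.erase j)} := by
  refine pivot_induction (P := fun n => pivot K n (gMonomial K T) ∈ Submodule.span K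
    {f | ∃ (j : ℕ) (C : Finset ℕ), j ∈ T ∧ n ≤ j ∧
      Disjoint C (T.erase j) ∧ (∀ i ∈ C, n ≤ i ∧ i + 2 ≤ j) ∧ ∑ i ∈ C, wt i + wt n = wt j ∧
      f = gMonomial K (C ∪ T.erase j)}) ?_ ?_ n
  · obtain ⟨N, hN⟩ := eventually_partialD_eq_zero K (gMonomial K T)
    refine ⟨N, fun n hn => ?_⟩
    rw [pivot_eq_zero fun k hk => hN k (by omega)]
    exact zero_mem _
  · intro n ih
    rw [pivot_rec]
    refine add_mem ?_ ?_
    · by_cases h : n ∈ T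
      · rw [(partialD_gMonomial_of_mem K h).mem_iff]
        exact Submodule.subset_span ⟨n, ∅, h, le_rfl, by simp, by simp, by simp, by simp⟩
      · rw [partialD_gMonomial_of_notMem K h]; exact zero_mem _
    · have h2 : ∀ f, letter K n * (letter K (n + 1) * f) =
          (LinearMap.mulLeft K (letter K n) ∘ₗ LinearMap.mulLeft K (letter K (n + 1))) f :=
        fun f => rfl
      rw [h2, ← Submodule.mem_comap]
      refine (Submodule.span_le.2 ?_) ih
      rintro _ ⟨j, C, hj, hnj, hd, hC, hw, rfl⟩
      rw [SetLike.mem_coe, Submodule.mem_comap, ← h2]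
      -- Multiplication by $x_nx_{n+1}$ either repeats a letter and gives zero, or enlarges `C` by
      -- $n,n+1$. The weight balance is then the recursion of `wt`.
      by_cases h1 : n + 1 ∈ C ∪ T.erase j
      · rw [letter_mul_gMonomial_of_mem K h1, mul_zero]; exact zero_mem _
      rw [((SignEq.refl (letter K n)).mul (letter_mul_gMonomial K h1)).mem_iff]
      by_cases h3 : n ∈ insert (n + 1) (C ∪ T.erase j)
      · rw [letter_mul_gMonomial_of_mem K h3]; exact zero_mem _
      rw [(letter_mul_gMonomial K h3).mem_iff]
      refine Submodule.subset_span ⟨j, insert n (insert (n + 1) C), hj, by omega, ?_, ?_, ?_, ?_⟩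
      · simp only [Finset.mem_insert, Finset.mem_union, not_or] at h1 h3
        rw [Finset.disjoint_insert_left, Finset.disjoint_insert_left]
        exact ⟨h3.2.2, h1.2, hd⟩
      · intro i hi
        simp only [Finset.mem_insert] at hi
        rcases hi with rfl | rfl | hi
        · omega
        · omega
        · have := hC i hi; omega
      · simp only [Finset.mem_insert, Finset.mem_union, not_or] at h1 h3
        rw [Finset.sum_insert (by simp [h3.2.1]), Finset.sum_insert h1.1, ← hw, wt_add_three]
        ring
      · rw [Finset.insert_union, Finset.insert_union]

/-! ### Anticommutators of pivot elements as single monomials -/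

/-- `v_n v_m + v_m v_n`. -/
def anti (K : Type*) [Field K] (n m : ℕ) : Module.End K (Grassmann K) :=
  pivot K n * pivot K m + pivot K m * pivot K n

theorem anti_apply (n m : ℕ) (f : Grassmann K) :
    anti K n m f = pivot K n (pivot K m f) + pivot K m (pivot K n f) := rfl

theorem anti_self (n : ℕ) : anti K n n = (2 : K) • monomialOp K {n + 1} (n + 3) := by
  refine LinearMap.ext fun f => ?_
  rw [anti_apply, pivot_pivot, two_smul, monomialOp_eq]
  simp [gMonomial]

theorem anti_succ (n : ℕ) : anti K n (n + 1) = -monomialOp K {n} (n + 3) := by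
  refine LinearMap.ext fun f => ?_
  rw [anti_apply, pivot_anticomm_succ, monomialOp_eq]
  simp [gMonomial]

theorem signEq_gMonomial_triple (n : ℕ) :
    SignEq (letter K n * (letter K (n + 1) * letter K (n + 2))) (gMonomial K {n, n + 1, n + 2}) := by
  have := signEq_prod_toFinset K (l := [n, n + 1, n + 2]) (by simp)
  simpa using this

theorem anti_two (n : ℕ) :
    SignEq (anti K n (n + 2)) (monomialOp K {n, n + 1, n + 2} (n + 5)) := by
  have h : anti K n (n + 2) =
      -(LinearMap.mulLeft K (letter K n * (letter K (n + 1) * letter K (n + 2))) * pivot K (n + 5)) := by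
    refine LinearMap.ext fun f => ?_
    rw [anti_apply, pivot_anticomm_two]
    simp
  rw [h, monomialOp_eq]
  refine SignEq.trans (Or.inr rfl) (SignEq.mul ?_ (SignEq.refl _))
  exact (signEq_gMonomial_triple n).map (LinearMap.mul K (Grassmann K))

theorem anti_step {n m : ℕ} (h : n + 2 ≤ m) :
    anti K n m = LinearMap.mulLeft K (letter K n * letter K (n + 1)) * anti K (n + 3) m := by
  refine LinearMap.ext fun f => ?_
  rw [anti_apply, pivot_anticomm_step h, Module.End.mul_apply, anti_apply]
  simp

theorem letter_mul_monomialOp {i : ℕ} {S : Finset ℕ} (h : i ∉ S) (n : ℕ) :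
    SignEq (LinearMap.mulLeft K (letter K i) * monomialOp K S n) (monomialOp K (insert i S) n) := by
  rw [monomialOp_eq, monomialOp_eq, ← mul_assoc]
  refine SignEq.mul ?_ (SignEq.refl _)
  have := (letter_mul_gMonomial K h).map (LinearMap.mul K (Grassmann K))
  have h2 : LinearMap.mulLeft K (letter K i) * LinearMap.mulLeft K (gMonomial K S) =
      LinearMap.mul K (Grassmann K) (letter K i * gMonomial K S) := by
    refine LinearMap.ext fun f => ?_; simp [mul_assoc]
  rw [h2]
  exact this

/-- The supercommutator of two pivot elements is a multiple of one monomial. -/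
theorem exists_anti (n m : ℕ) (h : n ≤ m) : ∃ (c : K) (D : Finset ℕ) (l : ℕ),
    anti K n m = c • monomialOp K D l ∧ (∀ i ∈ D, n ≤ i) ∧ m < l ∧ (n + 3 ≤ m → n ∈ D) ∧
    ∑ i ∈ D, wt i + wt n + wt m = wt l ∧
    (((∀ i ∈ D, i + 3 ≤ l) ∧ m + 1 ≤ l) ∨
      ((2 : K) = 0 → c = 0) ∧ l = m + 3 ∧ m + 1 ∈ D ∧ ∀ i ∈ D, i = m + 1 ∨ i + 2 ≤ m) := by
  obtain ⟨d, rfl⟩ := Nat.exists_eq_add_of_le h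
  clear h
  induction d using Nat.strong_induction_on generalizing n with
  | _ d ih =>
    match d, ih with
    | 0, _ =>
      -- The only base case producing the second shape. Its coefficient 2 is the reason why that
      -- shape drops out of brackets of pivots in characteristic 2.
      refine ⟨2, {n + 1}, n + 3, anti_self n, by simp, by omega, by omega, ?_, Or.inr ⟨id, rfl, ?_⟩⟩
      · rw [Finset.sum_singleton, wt_add_three]; simp; ring
      · simp
    | 1, _ =>
      refine ⟨-1, {n}, n + 3, by rw [anti_succ]; exact (neg_one_smul K _).symm, by simp, by omega, by omega, ?_,
        Or.inl ⟨by simp, by omega⟩⟩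
      rw [Finset.sum_singleton, wt_add_three]; ring
    | 2, _ =>
      obtain ⟨c, -, hc⟩ := (anti_two (K := K) n).exists_smul K
      refine ⟨c, _, _, hc, by simp, by omega, by omega, ?_, Or.inl ⟨by simp, by omega⟩⟩
      rw [Finset.sum_insert (by simp), Finset.sum_insert (by simp), Finset.sum_singleton,
        wt_add_three (n + 2), wt_add_three n]
      ring
    | d + 3, ih =>
      -- All letters of the inner anticommutator have index at least $n+3$, so prepending
      -- $x_nx_{n+1}$ never repeats a letter.
      obtain ⟨c, D, l, hD, hn, hl, -, hw, hs⟩ := ih d (by omega) (n + 3)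
      rw [show n + 3 + d = n + (d + 3) by ring] at hD hl hw hs
      have h1 : n + 1 ∉ D := fun h => by have := hn _ h; omega
      have h2 : n ∉ insert (n + 1) D := fun h => by
        rw [Finset.mem_insert] at h
        rcases h with h | h
        · omega
        · have := hn _ h; omega
      have h3 : SignEq (LinearMap.mulLeft K (letter K n * letter K (n + 1)) * monomialOp K D l)
          (monomialOp K (insert n (insert (n + 1) D)) l) := by
        have : LinearMap.mulLeft K (letter K n * letter K (n + 1)) =
            LinearMap.mulLeft K (letter K n) * LinearMap.mulLeft K (letter K (n + 1)) := by
          refine LinearMap.ext fun f => ?_; simp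
        rw [this, mul_assoc]
        exact ((SignEq.refl _).mul (letter_mul_monomialOp h1 l)).trans
          (letter_mul_monomialOp h2 l)
      obtain ⟨e, -, he⟩ := h3.exists_smul K
      refine ⟨c * e, insert n (insert (n + 1) D), l, ?_, ?_, hl, by simp, ?_, ?_⟩
      · rw [anti_step (by omega), hD, mul_smul_comm, he, smul_smul]
      · intro i hi
        simp only [Finset.mem_insert] at hi
        rcases hi with rfl | rfl | hi
        · omega
        · omega
        · have := hn i hi; omega
      · rw [Finset.sum_insert h2, Finset.sum_insert h1, ← hw, wt_add_three]; ring
      · rcases hs with ⟨hs, hs'⟩ | ⟨h0, hl', hm, hs⟩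
        · refine Or.inl ⟨fun i hi => ?_, hs'⟩
          simp only [Finset.mem_insert] at hi
          rcases hi with rfl | rfl | hi
          · omega
          · omega
          · exact hs i hi
        · refine Or.inr ⟨fun h => by rw [h0 h, zero_mul], hl', by simp [hm], fun i hi => ?_⟩
          simp only [Finset.mem_insert] at hi
          rcases hi with rfl | rfl | hi
          · omega
          · omega
          · exact hs i hi

end

theorem superBracket_signEq_swap {K V : Type*} [Field K] [AddCommGroup V] [Module K V]
    (𝒱 : ZMod 2 → Submodule K V) [DirectSum.Decomposition 𝒱] {s t : ZMod 2} {a b : Module.End K V}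
    (ha : a ∈ endPart 𝒱 s) (hb : b ∈ endPart 𝒱 t) :
    SignEq (superBracket 𝒱 b a) (superBracket 𝒱 a b) := by
  rw [superBracket_swap 𝒱 ha hb]
  rcases neg_one_pow_eq_or K (s.val * t.val) with h | h
  · rw [h]; exact Or.inr (neg_one_smul K _)
  · rw [h, neg_neg]; exact Or.inl (one_smul K _)

section

variable {K : Type*} [Field K]

/-! ### Parity -/

theorem partialD_mem (n : ℕ) {t : ZMod 2} {f : Grassmann K} (hf : f ∈ grassmannPart K t) :
    partialD K n f ∈ grassmannPart K (1 + t) := by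
  have hι : ∀ m, ∀ x : Grassmann K, partialD K n (CliffordAlgebra.ι 0 m * x) =
      m n • x - CliffordAlgebra.ι 0 m * partialD K n x := fun m x =>
    CliffordAlgebra.contractLeft_ι_mul _ _ _
  have hstep : ∀ s, ∀ m₁ m₂ : ℕ →₀ K, ∀ x : Grassmann K, x ∈ grassmannPart K s →
      partialD K n x ∈ grassmannPart K (1 + s) → partialD K n
        (CliffordAlgebra.ι 0 m₁ * CliffordAlgebra.ι 0 m₂ * x) ∈ grassmannPart K (1 + s) := by
    intro s m₁ m₂ x hx hx'
    rw [mul_assoc, hι, hι, mul_sub, ← mul_assoc]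
    have h1 := CliffordAlgebra.ι_mem_evenOdd_one (0 : QuadraticForm K (ℕ →₀ K))
    refine sub_mem (Submodule.smul_mem _ _ (SetLike.mul_mem_graded (h1 _) hx)) (sub_mem ?_ ?_)
    · exact SetLike.mul_mem_graded (h1 _) (Submodule.smul_mem _ _ hx)
    · have := SetLike.mul_mem_graded (CliffordAlgebra.ι_mul_ι_mem_evenOdd_zero _ m₁ m₂) hx'
      rwa [zero_add] at this
  have ht : ∀ t : ZMod 2, t = 0 ∨ t = 1 := by decide
  rcases ht t with rfl | rfl
  · induction f, hf using CliffordAlgebra.even_induction with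
    | algebraMap r =>
      rw [partialD, CliffordAlgebra.contractLeft_algebraMap]; exact zero_mem _
    | add x y _ _ hx hy => rw [map_add]; exact add_mem hx hy
    | ι_mul_ι_mul m₁ m₂ x hx hx' => exact hstep _ m₁ m₂ x hx hx'
  · induction f, hf using CliffordAlgebra.odd_induction with
    | ι v =>
      rw [partialD, CliffordAlgebra.contractLeft_ι]
      exact SetLike.algebraMap_mem_graded (A := CliffordAlgebra.evenOdd (0 : QuadraticForm K (ℕ →₀ K))) _
    | add x y _ _ hx hy => rw [map_add]; exact add_mem hx hy
    | ι_mul_ι_mul m₁ m₂ x hx hx' => exact hstep _ m₁ m₂ x hx hx'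

theorem pivot_mem (n : ℕ) : pivot K n ∈ endPart (grassmannPart K) 1 := by
  intro t f hf
  obtain ⟨N, hN⟩ := eventually_partialD_eq_zero K f
  refine pivot_induction (P := fun n => pivot K n f ∈ grassmannPart K (1 + t))
    ⟨N, fun k hk => ?_⟩ (fun k hk => ?_) n
  · rw [pivot_eq_zero fun j hj => hN j (by omega)]; exact zero_mem _
  · rw [pivot_rec]
    refine add_mem (partialD_mem k hf) ?_
    have := SetLike.mul_mem_graded (letter_mem K k) (SetLike.mul_mem_graded (letter_mem K (k + 1)) hk)
    rwa [← add_assoc, show (1 + 1 : ZMod 2) = 0 from rfl, zero_add] at this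

theorem monomialOp_mem (S : Finset ℕ) (n : ℕ) :
    monomialOp K S n ∈ endPart (grassmannPart K) (((S.card + 1 : ℕ)) : ZMod 2) := by
  rw [monomialOp_eq, Nat.cast_succ]
  refine mul_mem_endPart (fun t f hf => ?_) (pivot_mem n)
  exact SetLike.mul_mem_graded (gMonomial_mem K S) hf

/-! ### The bracket of two monomials -/

theorem neg_one_pow_val_mul_val (a b : ℕ) :
    (-1 : K) ^ ((a : ZMod 2).val * (b : ZMod 2).val) = (-1) ^ (a * b) := by
  rw [ZMod.val_natCast, ZMod.val_natCast, neg_one_pow_eq_pow_mod_two, ← Nat.mul_mod,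
    ← neg_one_pow_eq_pow_mod_two]

theorem gMonomial_comm (S T : Finset ℕ) : gMonomial K T * gMonomial K S =
    (-1 : K) ^ (S.card * T.card) • (gMonomial K S * gMonomial K T) := by
  have h1 : ∀ i, ∀ l : List ℕ, (l.map (letter K)).prod * letter K i =
      (-1 : K) ^ l.length • (letter K i * (l.map (letter K)).prod) := by
    intro i l
    induction l with
    | nil => simp
    | cons j l ih =>
      rw [List.map_cons, List.prod_cons, mul_assoc, ih, List.length_cons, pow_succ, mul_smul_comm,
        ← mul_assoc, letter_mul_letter K j i]
      simp [mul_assoc]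
  have h2 : ∀ l l' : List ℕ, (l'.map (letter K)).prod * (l.map (letter K)).prod =
      (-1 : K) ^ (l.length * l'.length) • ((l.map (letter K)).prod * (l'.map (letter K)).prod) := by
    intro l l'
    induction l with
    | nil => simp
    | cons j l ih =>
      rw [List.map_cons, List.prod_cons, ← mul_assoc, h1, smul_mul_assoc, mul_assoc, ih,
        mul_smul_comm, smul_smul, List.length_cons, ← pow_add, mul_assoc]
      congr 2
      ring
  simpa [gMonomial] using h2 (S.sort (· ≤ ·)) (T.sort (· ≤ ·))

/-- The bracket `[x_S v_n, x_T v_m]` when `v_m` does not act on `x_S`. -/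
theorem superBracket_monomialOp {S : Finset ℕ} {m : ℕ} (h : ∀ i ∈ S, i < m) (T : Finset ℕ) (n : ℕ) :
    superBracket (grassmannPart K) (monomialOp K S n) (monomialOp K T m) =
      LinearMap.mulLeft K (gMonomial K S * pivot K n (gMonomial K T)) * pivot K m +
        (-1 : K) ^ T.card • (LinearMap.mulLeft K (gMonomial K S * gMonomial K T) * anti K n m) := by
  rw [superBracket_of_mem _ (monomialOp_mem S n) (monomialOp_mem T m), neg_one_pow_val_mul_val]
  refine LinearMap.ext fun f => ?_
  have h1 : monomialOp K S n (monomialOp K T m f) = gMonomial K S * pivot K n (gMonomial K T) *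
      pivot K m f + (-1 : K) ^ T.card • (gMonomial K S * gMonomial K T *
        pivot K n (pivot K m f)) := by
    change gMonomial K S * pivot K n (gMonomial K T * pivot K m f) = _
    rw [pivot_mul, inv_gMonomial, mul_add, smul_mul_assoc, mul_smul_comm]
    simp only [mul_assoc]
  have h2 : monomialOp K T m (monomialOp K S n f) = ((-1 : K) ^ S.card *
      (-1 : K) ^ (S.card * T.card)) • (gMonomial K S * gMonomial K T *
        pivot K m (pivot K n f)) := by
    change gMonomial K T * pivot K m (gMonomial K S * pivot K n f) = _
    rw [pivot_mul, inv_gMonomial, pivot_gMonomial_of_lt h, zero_mul, zero_add, smul_mul_assoc,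
      mul_smul_comm, ← mul_assoc, gMonomial_comm, smul_mul_assoc, smul_smul]
  -- With this total sign the products $v_nv_m$ and $v_mv_n$ get the same coefficient after the
  -- subtraction, so they combine into the anticommutator.
  have h3 : (-1 : K) ^ ((S.card + 1) * (T.card + 1)) * ((-1 : K) ^ S.card *
      (-1 : K) ^ (S.card * T.card)) = -(-1) ^ T.card := by
    have hu : (-1 : K) ^ S.card * (-1 : K) ^ S.card = 1 := by rw [← mul_pow]; simp
    have hp : (-1 : K) ^ (S.card * T.card) * (-1 : K) ^ (S.card * T.card) = 1 := by
      rw [← mul_pow]; simp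
    rw [show (S.card + 1) * (T.card + 1) = S.card * T.card + S.card + T.card + 1 by ring, pow_add,
      pow_add, pow_add]
    linear_combination (-(-1) ^ T.card) * ((-1 : K) ^ (S.card * T.card) *
      (-1 : K) ^ (S.card * T.card)) * hu - (-1) ^ T.card * hp
  rw [LinearMap.sub_apply, Module.End.mul_apply, h1, LinearMap.smul_apply, Module.End.mul_apply, h2,
    smul_smul, h3, LinearMap.add_apply, LinearMap.smul_apply, Module.End.mul_apply,
    Module.End.mul_apply, anti_apply, LinearMap.mulLeft_apply, LinearMap.mulLeft_apply, mul_add,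
    smul_add, neg_smul]
  abel

theorem superBracket_monomialOp_swap (S T : Finset ℕ) (n m : ℕ) :
    SignEq (superBracket (grassmannPart K) (monomialOp K S n) (monomialOp K T m))
      (superBracket (grassmannPart K) (monomialOp K T m) (monomialOp K S n)) := by
  exact superBracket_signEq_swap _ (monomialOp_mem T m) (monomialOp_mem S n)

/-- The monomials that can occur in the bracket `[x_S v_n, x_T v_m]`. -/
def bracketTerms (K : Type*) [Field K] (S T : Finset ℕ) (n m : ℕ) :
    Set (Module.End K (Grassmann K)) :=
  {A | ∃ U l, HasShape K U l ∧ n ≤ l ∧ m ≤ l ∧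
    ∑ i ∈ U, wt i + wt n + wt m = ∑ i ∈ S, wt i + ∑ i ∈ T, wt i + wt l ∧
    (0 < n → 0 < m → 0 ∈ S ∨ 0 ∈ T → 0 ∈ U) ∧ A = monomialOp K U l}

theorem mulLeft_mul_pivot_mem {W : Submodule K (Module.End K (Grassmann K))} {m : ℕ}
    {X : Set (Grassmann K)} {g f : Grassmann K} (hf : f ∈ Submodule.span K X)
    (h : ∀ x ∈ X, LinearMap.mulLeft K (g * x) * pivot K m ∈ W) :
    LinearMap.mulLeft K (g * f) * pivot K m ∈ W := by
  induction hf using Submodule.span_induction with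
  | mem x hx => exact h x hx
  | zero =>
    have : LinearMap.mulLeft K (g * 0) * pivot K m = 0 := by
      refine LinearMap.ext fun f => ?_; simp
    rw [this]; exact zero_mem _
  | add x y _ _ hx hy =>
    have : LinearMap.mulLeft K (g * (x + y)) * pivot K m =
        LinearMap.mulLeft K (g * x) * pivot K m + LinearMap.mulLeft K (g * y) * pivot K m := by
      refine LinearMap.ext fun f => ?_; simp [mul_add, add_mul, mul_assoc]
    rw [this]; exact add_mem hx hy
  | smul c x _ hx =>
    have : LinearMap.mulLeft K (g * (c • x)) * pivot K m =
        c • (LinearMap.mulLeft K (g * x) * pivot K m) := by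
      refine LinearMap.ext fun f => ?_; simp [mul_assoc]
    rw [this]; exact W.smul_mem _ hx

theorem signEq_mulLeft_mul {f g : Grassmann K} (h : SignEq f g) (T : Module.End K (Grassmann K)) :
    SignEq (LinearMap.mulLeft K f * T) (LinearMap.mulLeft K g * T) :=
  (h.map (LinearMap.mul K (Grassmann K))).mul (SignEq.refl T)

theorem mulLeft_zero_mul (T : Module.End K (Grassmann K)) :
    LinearMap.mulLeft K (0 : Grassmann K) * T = 0 := by
  refine LinearMap.ext fun f => ?_; simp

/-- `x_S (x_U v_l)` is `± x_{S ∪ U} v_l` or zero. -/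
theorem mulLeft_mul_monomialOp (S U : Finset ℕ) (l : ℕ) :
    Disjoint S U ∧ SignEq (LinearMap.mulLeft K (gMonomial K S) * monomialOp K U l)
        (monomialOp K (S ∪ U) l) ∨
      ¬ Disjoint S U ∧ LinearMap.mulLeft K (gMonomial K S) * monomialOp K U l = 0 := by
  have h : LinearMap.mulLeft K (gMonomial K S) * monomialOp K U l =
      LinearMap.mulLeft K (gMonomial K S * gMonomial K U) * pivot K l := by
    refine LinearMap.ext fun f => ?_; simp [monomialOp_eq]
  rcases gMonomial_mul K S U with ⟨hd, hs⟩ | ⟨hd, hs⟩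
  · exact Or.inl ⟨hd, by rw [h]; exact signEq_mulLeft_mul hs _⟩
  · exact Or.inr ⟨hd, by rw [h, hs, mulLeft_zero_mul]⟩

/-- The derivation part $x_Sv_n(x_T)v_m$ keeps the length $m$ and replaces a letter $x_j$, $j\ge n$,
by letters of index at most $j-2$. The part with $[v_n,v_m]$ raises the length enough to accommodate
the letters of `S` and `T`, all of index at most $m-2$. -/
theorem superBracket_mem_of_le {S T : Finset ℕ} {n m : ℕ} (hnm : n ≤ m) (hS : HasShape K S n)
    (hT : HasShape K T m) :
    superBracket (grassmannPart K) (monomialOp K S n) (monomialOp K T m) ∈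
      Submodule.span K (bracketTerms K S T n m) := by
  have hS' : ∀ i ∈ S, i + 2 ≤ n := fun i hi => hS.add_two_le hi
  have hT' : ∀ i ∈ T, i + 2 ≤ m := fun i hi => hT.add_two_le hi
  rw [superBracket_monomialOp (fun i hi => by have := hS' i hi; omega)]
  refine add_mem (mulLeft_mul_pivot_mem (pivot_gMonomial_mem T n) ?_) (Submodule.smul_mem _ _ ?_)
  · rintro _ ⟨j, C, hj, hnj, hd, hC, hw, rfl⟩
    rcases gMonomial_mul K S (C ∪ T.erase j) with ⟨hd', hs⟩ | ⟨-, hs⟩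
    swap
    · rw [hs, mulLeft_zero_mul]; exact zero_mem _
    rw [(signEq_mulLeft_mul hs _).mem_iff]
    refine Submodule.subset_span ⟨S ∪ (C ∪ T.erase j), m, ?_, hnm, le_rfl, ?_, ?_, rfl⟩
    · rcases hT with hT | ⟨h3, hm, hT, h2⟩
      · have := hT j hj
        refine Or.inl fun i hi => ?_
        simp only [Finset.mem_union, Finset.mem_erase] at hi
        rcases hi with hi | hi | hi
        · have := hS' i hi; omega
        · have := hC i hi; omega
        · exact hT i hi.2
      -- Differentiating the distinguished letter $x_{m-2}$ turns the second shape into the first;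
      -- differentiating another letter keeps the second shape. In characteristic 2 there is no
      -- other letter.
      · by_cases hjm : j = m - 2
        · refine Or.inl fun i hi => ?_
          simp only [Finset.mem_union, Finset.mem_erase] at hi
          rcases hi with hi | hi | hi
          · have := hS' i hi; omega
          · have := hC i hi; omega
          · have := hT i hi.2; omega
        · have hj5 := hT j hj
          refine Or.inr ⟨h3, ?_, fun i hi => ?_, fun h => ?_⟩
          · simp only [Finset.mem_union, Finset.mem_erase]
            exact Or.inr (Or.inr ⟨Ne.symm hjm, hm⟩)
          · simp only [Finset.mem_union, Finset.mem_erase] at hi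
            rcases hi with hi | hi | hi
            · have := hS' i hi; omega
            · have := hC i hi; omega
            · exact hT i hi.2
          · rw [h2 h, Finset.mem_singleton] at hj
            exact absurd hj hjm
    · rw [Finset.sum_union hd', Finset.sum_union hd, ← Finset.sum_erase_add _ _ hj]
      omega
    · intro hn _ h0
      simp only [Finset.mem_union, Finset.mem_erase]
      rcases h0 with h0 | h0
      · exact Or.inl h0
      -- The removed letter $x_j$ has $j\ge n>0$, so $x_0$ is kept.
      · exact Or.inr (Or.inr ⟨by omega, h0⟩)
  · obtain ⟨c, D, l, hD, -, hl, -, hw, hs⟩ := exists_anti (K := K) n m hnm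
    rw [hD, mul_smul_comm]
    by_cases hc : c = 0
    · rw [hc, zero_smul]; exact zero_mem _
    refine Submodule.smul_mem _ _ ?_
    rcases gMonomial_mul K S T with ⟨hd, hST⟩ | ⟨-, hST⟩
    swap
    · rw [hST, mulLeft_zero_mul]; exact zero_mem _
    rw [(signEq_mulLeft_mul hST _).mem_iff]
    rcases mulLeft_mul_monomialOp (K := K) (S ∪ T) D l with ⟨hd', hU⟩ | ⟨-, hU⟩
    swap
    · rw [hU]; exact zero_mem _
    rw [hU.mem_iff]
    refine Submodule.subset_span ⟨S ∪ T ∪ D, l, ?_, by omega, by omega, ?_, ?_, rfl⟩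
    · rcases hs with ⟨hs, hm⟩ | ⟨h2, hl, hm, hs⟩
      · refine Or.inl fun i hi => ?_
        simp only [Finset.mem_union] at hi
        rcases hi with (hi | hi) | hi
        · have := hS' i hi; omega
        · have := hT' i hi; omega
        · exact hs i hi
      · refine Or.inr ⟨by omega, ?_, fun i hi => ?_, fun h => absurd (h2 h) hc⟩
        · simp only [Finset.mem_union]
          rw [hl]
          exact Or.inr hm
        · simp only [Finset.mem_union] at hi
          rcases hi with (hi | hi) | hi
          · have := hS' i hi; omega
          · have := hT' i hi; omega
          · have := hs i hi; omega
    · rw [Finset.sum_union hd', Finset.sum_union hd]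
      omega
    · intro _ _ h0
      simp only [Finset.mem_union]
      exact Or.inl h0

theorem superBracket_mem {S T : Finset ℕ} {n m : ℕ} (hS : HasShape K S n)
    (hT : HasShape K T m) :
    superBracket (grassmannPart K) (monomialOp K S n) (monomialOp K T m) ∈
      Submodule.span K (bracketTerms K S T n m) := by
  rcases le_total n m with h | h
  · exact superBracket_mem_of_le h hS hT
  · rw [(superBracket_monomialOp_swap S T n m).mem_iff]
    refine Submodule.span_mono ?_ (superBracket_mem_of_le h hT hS)
    rintro _ ⟨U, l, h1, h2, h3, h4, h5, rfl⟩
    exact ⟨U, l, h1, h3, h2, by omega, fun hn hm h0 => h5 hm hn h0.symm, rfl⟩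

/-- The square of a monomial vanishes unless the monomial is a pivot element. -/
theorem monomialOp_mul_self {S : Finset ℕ} {n : ℕ} (hS : HasShape K S n) :
    (S.Nonempty ∧ monomialOp K S n * monomialOp K S n = 0) ∨
      S = ∅ ∧ monomialOp K S n * monomialOp K S n = monomialOp K {n + 1} (n + 3) := by
  rcases S.eq_empty_or_nonempty with rfl | hne
  · refine Or.inr ⟨rfl, LinearMap.ext fun f => ?_⟩
    rw [monomialOp_empty, Module.End.mul_apply, pivot_pivot, monomialOp_eq]
    simp [gMonomial]
  · refine Or.inl ⟨hne, LinearMap.ext fun f => ?_⟩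
    change gMonomial K S * pivot K n (gMonomial K S * pivot K n f) = 0
    obtain ⟨i, hi⟩ := hne
    rw [pivot_mul, inv_gMonomial, pivot_gMonomial_of_lt fun i hi => by
      have := hS.add_two_le hi; omega]
    rw [zero_mul, zero_add, smul_mul_assoc, mul_smul_comm, ← mul_assoc,
      gMonomial_mul_of_mem K hi hi, zero_mul, smul_zero]

end

section

variable {K : Type*} [Field K]

/-! ### The span of the basis monomials -/

theorem monomialOp_mem_superQFrom {S : Finset ℕ} {n m : ℕ} (h : IsBasisMonomial K S n)
    (hm : m ≤ n) : monomialOp K S n ∈ superQFrom K m :=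
  Submodule.subset_span ⟨S, n, h, hm, rfl⟩

theorem superQFrom_le {m : ℕ} {W : Submodule K (Module.End K (Grassmann K))}
    (h : ∀ S n, IsBasisMonomial K S n → m ≤ n → monomialOp K S n ∈ W) : superQFrom K m ≤ W := by
  refine Submodule.span_le.2 ?_
  rintro _ ⟨S, n, h1, h2, rfl⟩
  exact h S n h1 h2

theorem superQFrom_anti {k m : ℕ} (h : k ≤ m) : superQFrom K m ≤ superQFrom K k :=
  superQFrom_le fun _ _ h1 h2 => monomialOp_mem_superQFrom h1 (h.trans h2)

theorem superQFromX0_le (m : ℕ) : superQFromX0 K m ≤ superQFrom K m := by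
  refine Submodule.span_mono ?_
  rintro _ ⟨S, n, h1, h2, _, rfl⟩
  exact ⟨S, n, h1, h2, rfl⟩

theorem isGraded_superQFrom (m : ℕ) : IsGraded (grassmannPart K) (superQFrom K m) :=
  isGraded_span _ (by rintro _ ⟨S, n, -, -, rfl⟩; exact ⟨_, monomialOp_mem S n⟩)

theorem isGraded_superQFromX0 (m : ℕ) : IsGraded (grassmannPart K) (superQFromX0 K m) :=
  isGraded_span _ (by rintro _ ⟨S, n, -, -, -, rfl⟩; exact ⟨_, monomialOp_mem S n⟩)

/-- The monomials of the bracket have the right shape, and their weight is a sum of two nonnegative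
weights, so no exceptional monomial occurs. -/
theorem superBracket_mem_superQFrom {k m : ℕ} {a b : Module.End K (Grassmann K)}
    (ha : a ∈ superQFrom K k) (hb : b ∈ superQFrom K m) :
    superBracket (grassmannPart K) a b ∈ superQFrom K (max k m) := by
  refine superBracket_mem_span _ ?_ ha hb
  rintro _ ⟨S, n, hS, hn, rfl⟩ _ ⟨T, l, hT, hl, rfl⟩
  rw [isBasisMonomial_iff] at hS hT
  refine (Submodule.span_le.2 ?_) (superBracket_mem hS.1 hT.1)
  rintro _ ⟨U, p, hU, h1, h2, hw, -, rfl⟩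
  exact monomialOp_mem_superQFrom ((isBasisMonomial_iff K U p).2 ⟨hU, by omega⟩) (by omega)

/-- Only $v_0$ could remove the letter $x_0$, and $m\ge1$ excludes it. -/
theorem superBracket_mem_superQFromX0 {m : ℕ} (hm : 1 ≤ m) {a b : Module.End K (Grassmann K)}
    (ha : a ∈ superQFrom K m) (hb : b ∈ superQFromX0 K m) :
    superBracket (grassmannPart K) a b ∈ superQFromX0 K m ∧
      superBracket (grassmannPart K) b a ∈ superQFromX0 K m := by
  constructor
  · refine superBracket_mem_span _ ?_ ha hb
    rintro _ ⟨S, n, hS, hn, rfl⟩ _ ⟨T, l, hT, hl, h0, rfl⟩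
    rw [isBasisMonomial_iff] at hS hT
    refine (Submodule.span_le.2 ?_) (superBracket_mem hS.1 hT.1)
    rintro _ ⟨U, p, hU, h1, h2, hw, hU0, rfl⟩
    exact Submodule.subset_span ⟨U, p, (isBasisMonomial_iff K U p).2 ⟨hU, by omega⟩, by omega,
      hU0 (by omega) (by omega) (Or.inr h0), rfl⟩
  · refine superBracket_mem_span _ ?_ hb ha
    rintro _ ⟨S, n, hS, hn, h0, rfl⟩ _ ⟨T, l, hT, hl, rfl⟩
    rw [isBasisMonomial_iff] at hS hT
    refine (Submodule.span_le.2 ?_) (superBracket_mem hS.1 hT.1)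
    rintro _ ⟨U, p, hU, h1, h2, hw, hU0, rfl⟩
    exact Submodule.subset_span ⟨U, p, (isBasisMonomial_iff K U p).2 ⟨hU, by omega⟩, by omega,
      hU0 (by omega) (by omega) (Or.inl h0), rfl⟩

theorem isBasisMonomial_empty (n : ℕ) : IsBasisMonomial K ∅ n :=
  (isBasisMonomial_iff K _ _).2 ⟨Or.inl (by simp), by simp⟩

theorem isBasisMonomial_square (n : ℕ) : IsBasisMonomial K {n + 1} (n + 3) := by
  refine (isBasisMonomial_iff K _ _).2 ⟨Or.inr ⟨by omega, by simp, by simp, fun _ => by simp⟩, ?_⟩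
  rw [Finset.sum_singleton, wt_add_three]; omega

theorem square_mem_superQFrom {m : ℕ} {a : Module.End K (Grassmann K)} (ha : a ∈ superQFrom K m)
    (hodd : a ∈ endPart (grassmannPart K) 1) : a * a ∈ superQFrom K m := by
  refine square_mem_of_span _ ?_ ?_ ?_ ha hodd
  · rintro _ ⟨S, n, -, -, rfl⟩; exact ⟨_, monomialOp_mem S n⟩
  · rintro _ ⟨S, n, hS, hn, rfl⟩ _ ⟨T, l, hT, hl, rfl⟩
    have := superBracket_mem_superQFrom (monomialOp_mem_superQFrom hS hn)
      (monomialOp_mem_superQFrom hT hl)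
    rwa [max_self] at this
  · rintro _ ⟨S, n, hS, hn, rfl⟩ -
    rcases monomialOp_mul_self ((isBasisMonomial_iff K S n).1 hS).1 with ⟨-, h⟩ | ⟨-, h⟩
    · rw [h]; exact zero_mem _
    · rw [h]; exact monomialOp_mem_superQFrom (isBasisMonomial_square n) (by omega)

theorem pivot_mem_superQFrom {n m : ℕ} (h : m ≤ n) : pivot K n ∈ superQFrom K m := by
  rw [← monomialOp_empty]
  exact monomialOp_mem_superQFrom (isBasisMonomial_empty n) h

theorem superQ_le : superQ K ≤ superQFrom K 0 := by
  refine sInf_le ⟨⟨isGraded_superQFrom 0, fun a ha b hb => by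
      have := superBracket_mem_superQFrom ha hb
      rwa [max_self] at this,
    fun a ha h => square_mem_superQFrom ha h⟩, ?_⟩
  rintro _ (h | h | h) <;> rw [h] <;> exact pivot_mem_superQFrom (Nat.zero_le _)

/-! ### Producing monomials -/

/-- Bracketing with `v_i` removes the letter `x_i`. -/
theorem superBracket_pivot_monomialOp {U : Finset ℕ} {n i : ℕ} (hi : i ∈ U) (hn : i + 3 ≤ n) :
    SignEq (superBracket (grassmannPart K) (pivot K i) (monomialOp K U n))
      (monomialOp K (U.erase i) n) := by
  rw [← monomialOp_empty, superBracket_monomialOp (by simp), gMonomial_empty, one_mul, one_mul]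
  -- As $i+3\le n$, the anticommutator $[v_i,v_n]$ is a multiple of $x_i$, and $x_U$ already
  -- contains $x_i$. Only the derivation part remains.
  obtain ⟨c, D, l, hD, -, -, hiD, -⟩ := exists_anti (K := K) i n (by omega)
  have h : LinearMap.mulLeft K (gMonomial K U) * monomialOp K D l = 0 := by
    rcases mulLeft_mul_monomialOp (K := K) U D l with ⟨hd, -⟩ | ⟨-, h⟩
    · exact absurd (hiD hn) (Finset.disjoint_left.1 hd hi)
    · exact h
  rw [hD, mul_smul_comm, h, smul_zero, smul_zero, add_zero]
  exact signEq_mulLeft_mul (pivot_gMonomial_of_mem hi) _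

/-- Unwanted letters are removed one at a time by brackets with pivots, so it suffices to produce
monomials with maximal `S`. -/
theorem monomialOp_mem_of_subset {W : Submodule K (Module.End K (Grassmann K))}
    (hW : ∀ i, ∀ a ∈ W, superBracket (grassmannPart K) (pivot K i) a ∈ W) {S U : Finset ℕ} {n : ℕ}
    (hSU : S ⊆ U) (h : ∀ i ∈ U, i ∉ S → i + 3 ≤ n) (hU : monomialOp K U n ∈ W) :
    monomialOp K S n ∈ W := by
  have key : ∀ V : Finset ℕ, V ⊆ U → (∀ i ∈ V, i + 3 ≤ n) → monomialOp K (U \ V) n ∈ W := by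
    intro V
    induction V using Finset.induction_on with
    | empty => intro _ _; simpa using hU
    | insert i V hi ih =>
      intro hV hn
      have h1 := ih (fun j hj => hV (Finset.mem_insert_of_mem hj))
        fun j hj => hn j (Finset.mem_insert_of_mem hj)
      have h2 : i ∈ U \ V := Finset.mem_sdiff.2 ⟨hV (Finset.mem_insert_self _ _), hi⟩
      have h3 := (superBracket_pivot_monomialOp (K := K) h2 (hn i (Finset.mem_insert_self _ _))).mem_iff W
      rw [Finset.sdiff_insert, ← h3]
      exact hW i _ h1
  have := key (U \ S) Finset.sdiff_subset fun i hi => by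
    rw [Finset.mem_sdiff] at hi; exact h i hi.1 hi.2
  rwa [Finset.sdiff_sdiff_eq_self hSU] at this

/-- Neither pivot differentiates the letters of the other factor, so the bracket reduces to $\pm
x_Sx_T[v_n,v_m]$, a nonzero multiple of one monomial. -/
theorem monomialOp_mem_of_superBracket_mem {W : Submodule K (Module.End K (Grassmann K))}
    {S T D : Finset ℕ} {n m l : ℕ} {c : K} (hc : c ≠ 0) (hD : anti K n m = c • monomialOp K D l)
    (h : superBracket (grassmannPart K) (monomialOp K S n) (monomialOp K T m) ∈ W)
    (hS : ∀ i ∈ S, i < m) (hT : ∀ i ∈ T, i < n) (hST : Disjoint S T) (hSTD : Disjoint (S ∪ T) D) :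
    monomialOp K (S ∪ T ∪ D) l ∈ W := by
  rw [superBracket_monomialOp hS, pivot_gMonomial_of_lt hT, mul_zero, mulLeft_zero_mul, zero_add,
    Submodule.smul_mem_iff _ (by simp), ((signEq_mulLeft_mul (gMonomial_mul_of_disjoint K hST)) _).mem_iff,
    hD, mul_smul_comm, Submodule.smul_mem_iff _ hc] at h
  rcases mulLeft_mul_monomialOp (K := K) (S ∪ T) D l with ⟨-, h'⟩ | ⟨h', -⟩
  · rwa [← h'.mem_iff]
  · exact absurd hSTD h'

theorem exists_anti_two (n : ℕ) :
    ∃ c : K, c ≠ 0 ∧ anti K n (n + 2) = c • monomialOp K {n, n + 1, n + 2} (n + 5) := by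
  obtain ⟨c, hc, h⟩ := (anti_two (K := K) n).exists_smul K
  exact ⟨c, by rcases hc with rfl | rfl <;> simp, h⟩

theorem exists_anti_succ (n : ℕ) :
    ∃ c : K, c ≠ 0 ∧ anti K n (n + 1) = c • monomialOp K {n} (n + 3) :=
  ⟨-1, by simp, by rw [anti_succ]; exact (neg_one_smul K _).symm⟩

theorem exists_anti_three (h2 : (2 : K) ≠ 0) (n : ℕ) :
    ∃ c : K, c ≠ 0 ∧ anti K n (n + 3) = c • monomialOp K {n, n + 1, n + 4} (n + 6) := by
  have h : LinearMap.mulLeft K (letter K n * letter K (n + 1)) * monomialOp K {n + 4} (n + 6) =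
      LinearMap.mulLeft K (letter K n * (letter K (n + 1) * letter K (n + 4))) * pivot K (n + 6) := by
    refine LinearMap.ext fun f => ?_
    simp [monomialOp_eq, gMonomial]
  have h3 := signEq_prod_toFinset K (l := [n, n + 1, n + 4]) (by simp)
  have h4 : ([n, n + 1, n + 4] : List ℕ).toFinset = {n, n + 1, n + 4} := by simp
  simp only [List.map_cons, List.map_nil, List.prod_cons, List.prod_nil, mul_one, h4] at h3
  obtain ⟨c, hc, hc'⟩ := (signEq_mulLeft_mul h3 (pivot K (n + 6))).exists_smul K
  refine ⟨2 * c, mul_ne_zero h2 (by rcases hc with rfl | rfl <;> simp), ?_⟩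
  rw [anti_step (by omega), anti_self, mul_smul_comm, h, hc', smul_smul, ← monomialOp_eq]

theorem monomialOp_mem_two {W : Submodule K (Module.End K (Grassmann K))} {S T : Finset ℕ} {n : ℕ}
    (h : superBracket (grassmannPart K) (monomialOp K S n) (monomialOp K T (n + 2)) ∈ W)
    (hS : ∀ i ∈ S, i < n) (hT : ∀ i ∈ T, i < n) (hST : Disjoint S T) :
    monomialOp K (S ∪ T ∪ {n, n + 1, n + 2}) (n + 5) ∈ W := by
  obtain ⟨c, hc, hD⟩ := exists_anti_two (K := K) n
  refine monomialOp_mem_of_superBracket_mem hc hD h (fun i hi => by have := hS i hi; omega) hT hST ?_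
  rw [Finset.disjoint_left]
  intro i hi
  have : i < n := (Finset.mem_union.1 hi).elim (hS i) (hT i)
  simp only [Finset.mem_insert, Finset.mem_singleton]; omega

theorem monomialOp_mem_succ {W : Submodule K (Module.End K (Grassmann K))} {S T : Finset ℕ} {n : ℕ}
    (h : superBracket (grassmannPart K) (monomialOp K S n) (monomialOp K T (n + 1)) ∈ W)
    (hS : ∀ i ∈ S, i < n) (hT : ∀ i ∈ T, i < n) (hST : Disjoint S T) :
    monomialOp K (S ∪ T ∪ {n}) (n + 3) ∈ W := by
  obtain ⟨c, hc, hD⟩ := exists_anti_succ (K := K) n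
  refine monomialOp_mem_of_superBracket_mem hc hD h (fun i hi => by have := hS i hi; omega) hT hST ?_
  rw [Finset.disjoint_left]
  intro i hi
  have : i < n := (Finset.mem_union.1 hi).elim (hS i) (hT i)
  simp only [Finset.mem_singleton]; omega

theorem monomialOp_mem_three (h2 : (2 : K) ≠ 0) {W : Submodule K (Module.End K (Grassmann K))}
    {S T : Finset ℕ} {n : ℕ}
    (h : superBracket (grassmannPart K) (monomialOp K S n) (monomialOp K T (n + 3)) ∈ W)
    (hS : ∀ i ∈ S, i < n) (hT : ∀ i ∈ T, i < n) (hST : Disjoint S T) :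
    monomialOp K (S ∪ T ∪ {n, n + 1, n + 4}) (n + 6) ∈ W := by
  obtain ⟨c, hc, hD⟩ := exists_anti_three h2 n
  refine monomialOp_mem_of_superBracket_mem hc hD h (fun i hi => by have := hS i hi; omega) hT hST ?_
  rw [Finset.disjoint_left]
  intro i hi
  have : i < n := (Finset.mem_union.1 hi).elim (hS i) (hT i)
  simp only [Finset.mem_insert, Finset.mem_singleton]; omega

theorem monomialOp_mem_zero (h2 : (2 : K) ≠ 0) {W : Submodule K (Module.End K (Grassmann K))}
    {S T : Finset ℕ} {n : ℕ}
    (h : superBracket (grassmannPart K) (monomialOp K S n) (monomialOp K T n) ∈ W)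
    (hS : ∀ i ∈ S, i < n) (hT : ∀ i ∈ T, i < n) (hST : Disjoint S T) :
    monomialOp K (S ∪ T ∪ {n + 1}) (n + 3) ∈ W := by
  refine monomialOp_mem_of_superBracket_mem h2 (anti_self n) h hS hT hST ?_
  rw [Finset.disjoint_left]
  intro i hi
  have : i < n := (Finset.mem_union.1 hi).elim (hS i) (hT i)
  simp only [Finset.mem_singleton]; omega

theorem range_union_triple (k : ℕ) : ∅ ∪ Finset.range k ∪ {k, k + 1, k + 2} = Finset.range (k + 3) := by
  ext i
  simp only [Finset.mem_union, Finset.mem_range, Finset.mem_insert, Finset.mem_singleton,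
    Finset.notMem_empty, false_or]
  omega

theorem range_union_triple' (k : ℕ) :
    ∅ ∪ Finset.range k ∪ {k, k + 1, k + 4} = insert (k + 4) (Finset.range (k + 2)) := by
  ext i
  simp only [Finset.mem_union, Finset.mem_range, Finset.mem_insert, Finset.mem_singleton,
    Finset.notMem_empty, false_or]
  omega

/-! ### All basis monomials are in `Q` -/

theorem superBracket_mem_superQ {a b : Module.End K (Grassmann K)} (ha : a ∈ superQ K)
    (hb : b ∈ superQ K) : superBracket (grassmannPart K) a b ∈ superQ K :=
  (isLieSubsuperalgebra_lieGenerated _ _).bracket_mem a ha b hb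

theorem pivot_mem_superQ (n : ℕ) : pivot K n ∈ superQ K := by
  have hgen : ({pivot K 0, pivot K 1, pivot K 2} : Set _) ⊆ superQ K := subset_lieGenerated _ _
  induction n using Nat.strong_induction_on with
  | _ n ih =>
    match n, ih with
    | 0, _ => exact hgen (Set.mem_insert _ _)
    | 1, _ => exact hgen (Set.mem_insert_of_mem _ (Set.mem_insert _ _))
    | 2, _ => exact hgen (Set.mem_insert_of_mem _ (Set.mem_insert_of_mem _ (Set.mem_singleton _)))
    | n + 3, ih =>
      -- $[v_n,v_{n+1}]=-x_nv_{n+3}$, and a further bracket with $v_n$ removes $x_n$.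
      have h1 := superBracket_mem_superQ (ih n (by omega)) (ih (n + 1) (by omega))
      rw [← monomialOp_empty, ← monomialOp_empty] at h1
      have h2 := monomialOp_mem_succ h1 (by simp) (by simp) (by simp)
      have h3 := superBracket_mem_superQ (ih n (by omega)) h2
      rw [(superBracket_pivot_monomialOp (by simp) le_rfl).mem_iff] at h3
      simpa [monomialOp_empty] using h3

theorem monomialOp_mem_superQ_of_subset {S U : Finset ℕ} {n : ℕ}
    (hSU : S ⊆ U) (h : ∀ i ∈ U, i ∉ S → i + 3 ≤ n) (hU : monomialOp K U n ∈ superQ K) :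
    monomialOp K S n ∈ superQ K :=
  monomialOp_mem_of_subset (fun i _ ha => superBracket_mem_superQ (pivot_mem_superQ i) ha) hSU h hU

theorem monomialOp_empty_mem_superQ (n : ℕ) : monomialOp K ∅ n ∈ superQ K := by
  rw [monomialOp_empty]; exact pivot_mem_superQ n

theorem monomialOp_mem_superQ_four : monomialOp K {1} 4 ∈ superQ K := by
  have h1 := superBracket_mem_superQ (monomialOp_empty_mem_superQ (K := K) 1)
    (monomialOp_empty_mem_superQ 2)
  simpa using monomialOp_mem_succ h1 (by simp) (by simp) (by simp)

theorem monomialOp_mem_superQ_five : monomialOp K {0, 1, 2} 5 ∈ superQ K := by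
  have h1 := superBracket_mem_superQ (monomialOp_empty_mem_superQ (K := K) 0)
    (monomialOp_empty_mem_superQ 2)
  simpa using monomialOp_mem_two h1 (by simp) (by simp) (by simp)

/-- In length 7 the letters $x_0$ and $x_3$ cannot occur together, so there are two maximal
monomials of the first type. This is the one without $x_0$, obtained from $[v_2,x_1v_4]$. -/
theorem monomialOp_mem_superQ_seven : monomialOp K {1, 2, 3, 4} 7 ∈ superQ K := by
  have h1 := superBracket_mem_superQ (monomialOp_empty_mem_superQ (K := K) 2)
    monomialOp_mem_superQ_four
  have h2 := monomialOp_mem_two (n := 2) h1 (by simp) (by simp) (by simp)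
  have h3 : (∅ ∪ {1} ∪ {2, 2 + 1, 2 + 2} : Finset ℕ) = {1, 2, 3, 4} := by decide
  rwa [h3] at h2

theorem monomialOp_mem_superQ_seven' : monomialOp K {0, 1, 2, 4} 7 ∈ superQ K := by
  have h1 := superBracket_mem_superQ (monomialOp_empty_mem_superQ (K := K) 4)
    monomialOp_mem_superQ_five
  have h2 := monomialOp_mem_succ (n := 4) h1 (by simp) (by simp) (by simp)
  have h3 : (∅ ∪ {0, 1, 2} ∪ {4} : Finset ℕ) = {0, 1, 2, 4} := by decide
  rwa [h3] at h2

/-- The maximal monomials of the first type satisfy $[v_k,x_0\cdots x_{k-1}v_{k+2}]=\pm x_0\cdots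
x_{k+2}v_{k+5}$, which gives an induction in steps of three. -/
theorem monomialOp_range_mem_superQ (n : ℕ) (h4 : n ≠ 4) (h7 : n ≠ 7) :
    monomialOp K (Finset.range (n - 2)) n ∈ superQ K := by
  induction n using Nat.strong_induction_on with
  | _ n ih =>
    match n, h4, h7, ih with
    | 0, _, _, _ => simpa using monomialOp_empty_mem_superQ (K := K) 0
    | 1, _, _, _ => simpa using monomialOp_empty_mem_superQ (K := K) 1
    | 2, _, _, _ => simpa using monomialOp_empty_mem_superQ (K := K) 2
    | 3, _, _, _ =>
      have h1 := superBracket_mem_superQ (monomialOp_empty_mem_superQ (K := K) 0)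
        (monomialOp_empty_mem_superQ 1)
      have h2 := monomialOp_mem_succ h1 (by simp) (by simp) (by simp)
      have h3 : (∅ ∪ ∅ ∪ {0} : Finset ℕ) = Finset.range (3 - 2) := by decide
      rwa [h3] at h2
    | k + 5, h4, h7, ih =>
      rw [show k + 5 - 2 = k + 3 by omega]
      by_cases hk : k = 5
      · subst hk
        have h1 : monomialOp K {3, 4} 7 ∈ superQ K :=
          monomialOp_mem_superQ_of_subset (U := {1, 2, 3, 4}) (by simp [Finset.insert_subset_iff])
            (by simp) monomialOp_mem_superQ_seven
        have h2 := superBracket_mem_superQ (monomialOp_mem_superQ_five (K := K)) h1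
        have h3 := monomialOp_mem_two (n := 5) h2 (by simp) (by simp) (by simp)
        have h4 : ({0, 1, 2} ∪ {3, 4} ∪ {5, 5 + 1, 5 + 2} : Finset ℕ) = Finset.range (5 + 3) := by
          decide
        rwa [h4] at h3
      by_cases hk : k = 2
      · omega
      have h1 := ih (k + 2) (by omega) (by omega) (by omega)
      rw [← range_union_triple]
      exact monomialOp_mem_two (superBracket_mem_superQ (monomialOp_empty_mem_superQ k) h1)
        (by simp) (by simp) (by simp)

theorem monomialOp_mem_superQ_of_isFirstType {S : Finset ℕ} {n : ℕ} (h : IsFirstType S n) :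
    monomialOp K S n ∈ superQ K := by
  obtain ⟨h, h4, h7⟩ := h
  by_cases hn4 : n = 4
  · subst hn4
    refine monomialOp_mem_superQ_of_subset (fun i hi => ?_) (by simp) monomialOp_mem_superQ_four
    have := h i hi
    have : i ≠ 0 := fun h0 => h4 ⟨rfl, h0 ▸ hi⟩
    simp only [Finset.mem_singleton]; omega
  by_cases hn7 : n = 7
  · subst hn7
    by_cases h0 : 0 ∈ S
    · refine monomialOp_mem_superQ_of_subset (fun i hi => ?_) (by simp) monomialOp_mem_superQ_seven'
      have := h i hi
      have : i ≠ 3 := fun h3 => h7 ⟨rfl, h0, h3 ▸ hi⟩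
      simp only [Finset.mem_singleton, Finset.mem_insert]; omega
    · refine monomialOp_mem_superQ_of_subset (fun i hi => ?_) (by simp) monomialOp_mem_superQ_seven
      have := h i hi
      have : i ≠ 0 := fun h3 => h0 (h3 ▸ hi)
      simp only [Finset.mem_singleton, Finset.mem_insert]; omega
  refine monomialOp_mem_superQ_of_subset (fun i hi => ?_) (fun i hi _ => ?_)
    (monomialOp_range_mem_superQ n hn4 hn7)
  · have := h i hi
    rw [Finset.mem_range]; omega
  · rw [Finset.mem_range] at hi; omega

theorem monomialOp_square_mem_superQ (n : ℕ) : monomialOp K {n + 1} (n + 3) ∈ superQ K := by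
  have h := (isLieSubsuperalgebra_lieGenerated (grassmannPart K) _).square_mem _
    (pivot_mem_superQ (K := K) n) (pivot_mem n)
  rcases monomialOp_mul_self (K := K) (S := ∅) (n := n) (Or.inl (by simp)) with ⟨h', -⟩ | ⟨-, h'⟩
  · simp at h'
  · rw [monomialOp_empty] at h'
    rw [← h']
    exact h

theorem monomialOp_mem_superQ_of_isSecondType (h2 : (2 : K) ≠ 0) {S : Finset ℕ} {n : ℕ}
    (h : IsSecondType S n) : monomialOp K S n ∈ superQ K := by
  obtain ⟨h3, hS, h, h5, h7, h10⟩ := h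
  have hle : ∀ U : Finset ℕ, (∀ i ∈ U, i ≠ n - 2 → i + 5 ≤ n) → S ⊆ U →
      monomialOp K U n ∈ superQ K → monomialOp K S n ∈ superQ K := fun U hU hSU =>
    monomialOp_mem_superQ_of_subset hSU fun i hi hiS => by
      have := hU i hi (fun h => hiS (h ▸ hS)); omega
  by_cases hn5 : n ≤ 5
  · obtain ⟨k, rfl⟩ := Nat.exists_eq_add_of_le h3
    rw [add_comm 3 k] at *
    refine hle {k + 1} (by simp) (fun i hi => ?_) (monomialOp_square_mem_superQ k)
    have := h i hi
    have : k + 3 = 5 → i ≠ 0 := fun hk h0 => h5 ⟨hk, h0 ▸ hi⟩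
    rw [Finset.mem_singleton]; omega
  by_cases hn7 : n = 7
  · subst hn7
    have h1 := monomialOp_mem_three h2 (superBracket_mem_superQ
      (monomialOp_empty_mem_superQ (K := K) 1) (monomialOp_empty_mem_superQ 4))
      (by simp) (by simp) (by simp)
    refine hle _ (by decide) (fun i hi => ?_) h1
    have := h i hi
    have : i ≠ 0 := fun h0 => h7 ⟨rfl, h0 ▸ hi⟩
    simp only [Finset.mem_union, Finset.mem_insert, Finset.mem_singleton]; omega
  by_cases hn10 : n = 10
  · subst hn10
    have : 0 ∉ S ∨ 3 ∉ S ∨ 5 ∉ S := by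
      by_contra! hc
      exact h10 ⟨rfl, hc⟩
    rcases this with h0 | h0 | h0
    · have h1 : monomialOp K {1, 2, 3} 7 ∈ superQ K :=
        monomialOp_mem_superQ_of_isFirstType ⟨by decide, by decide, by decide⟩
      refine hle _ (by decide) (fun i hi => ?_) (monomialOp_mem_three h2 (superBracket_mem_superQ
        (monomialOp_empty_mem_superQ (K := K) 4) h1) (by decide) (by decide) (by decide))
      have := h i hi
      have : i ≠ 0 := fun h => h0 (h ▸ hi)
      simp only [Finset.mem_union, Finset.mem_insert, Finset.mem_singleton]; omega
    · have h1 : monomialOp K {0, 1, 2} 7 ∈ superQ K :=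
        monomialOp_mem_superQ_of_isFirstType ⟨by decide, by decide, by decide⟩
      refine hle _ (by decide) (fun i hi => ?_) (monomialOp_mem_three h2 (superBracket_mem_superQ
        (monomialOp_empty_mem_superQ (K := K) 4) h1) (by decide) (by decide) (by decide))
      have := h i hi
      have : i ≠ 3 := fun h => h0 (h ▸ hi)
      simp only [Finset.mem_union, Finset.mem_insert, Finset.mem_singleton]; omega
    · have h1 : monomialOp K {0, 1, 2} 7 ∈ superQ K :=
        monomialOp_mem_superQ_of_isFirstType ⟨by decide, by decide, by decide⟩
      have h1' : monomialOp K {3, 4} 7 ∈ superQ K :=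
        monomialOp_mem_superQ_of_isFirstType ⟨by decide, by decide, by decide⟩
      refine hle _ (by decide) (fun i hi => ?_) (monomialOp_mem_zero h2 (superBracket_mem_superQ
        h1 h1') (by decide) (by decide) (by decide))
      have := h i hi
      have : i ≠ 5 := fun h => h0 (h ▸ hi)
      simp only [Finset.mem_union, Finset.mem_insert, Finset.mem_singleton]; omega
  obtain ⟨k, rfl⟩ := Nat.exists_eq_add_of_le (show 6 ≤ n by omega)
  rw [add_comm 6 k] at *
  have h1 := monomialOp_range_mem_superQ (K := K) (k + 3) (by omega) (by omega)
  have h1' : monomialOp K (Finset.range k) (k + 3) ∈ superQ K := by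
    refine monomialOp_mem_superQ_of_subset (fun i hi => ?_) (fun i hi _ => ?_) h1
    · simp only [Finset.mem_range] at hi ⊢; omega
    · simp only [Finset.mem_range] at hi; omega
  have h4 := monomialOp_mem_three h2 (superBracket_mem_superQ
      (monomialOp_empty_mem_superQ (K := K) k) h1') (by simp) (by simp) (by simp)
  rw [range_union_triple'] at h4
  refine hle _ (fun i hi hi' => ?_) (fun i hi => ?_) h4
  · simp only [Finset.mem_insert, Finset.mem_range] at hi; omega
  · have := h i hi
    simp only [Finset.mem_insert, Finset.mem_range]; omega

theorem superQ_eq : superQ K = superQFrom K 0 := by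
  refine le_antisymm superQ_le (superQFrom_le fun S n h _ => ?_)
  rcases h with h | ⟨h2, h⟩ | ⟨-, h3, rfl⟩
  · exact monomialOp_mem_superQ_of_isFirstType h
  · exact monomialOp_mem_superQ_of_isSecondType h2 h
  · obtain ⟨k, rfl⟩ := Nat.exists_eq_add_of_le h3
    rw [add_comm 3 k]
    exact monomialOp_square_mem_superQ k

end

section

variable {K : Type*} [Field K]

/-! ### Codimensions -/

theorem finiteCodimIn_superQFrom (m : ℕ) : FiniteCodimIn (superQFrom K m) (superQ K) := by
  let X : Set (Module.End K (Grassmann K)) :=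
    {T | ∃ S n, IsBasisMonomial K S n ∧ n < m ∧ T = monomialOp K S n}
  have hX : X.Finite := by
    refine Set.Finite.subset (((Finset.range m).powerset ×ˢ Finset.range m).finite_toSet.image
      fun p : Finset ℕ × ℕ => monomialOp K p.1 p.2) ?_
    rintro _ ⟨S, n, hS, hn, rfl⟩
    refine ⟨(S, n), ?_, rfl⟩
    simp only [Finset.coe_product, Set.mem_prod, Finset.mem_coe, Finset.mem_powerset,
      Finset.mem_range]
    refine ⟨fun i hi => ?_, hn⟩
    have := ((isBasisMonomial_iff K S n).1 hS).1.add_two_le hi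
    rw [Finset.mem_range]; omega
  refine finiteCodimIn_of_span hX ?_ ?_
  · rintro _ ⟨S, n, hS, -, rfl⟩
    rw [superQ_eq]
    exact monomialOp_mem_superQFrom hS (Nat.zero_le _)
  · rw [superQ_eq]
    refine superQFrom_le fun S n hS _ => ?_
    by_cases hn : n < m
    · exact Submodule.mem_sup_left (Submodule.subset_span ⟨S, n, hS, hn, rfl⟩)
    · exact Submodule.mem_sup_right (monomialOp_mem_superQFrom hS (not_lt.1 hn))

/-- The augmentation of the Grassmann algebra. -/
abbrev augmentation (K : Type*) [Field K] : Grassmann K →ₐ[K] K :=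
  ExteriorAlgebra.algebraMapInv

theorem augmentation_letter (i : ℕ) : augmentation K (letter K i) = 0 := by
  simp [augmentation, ExteriorAlgebra.algebraMapInv, letter]

/-- The constant terms of the values of an endomorphism at the letters. -/
def symbolMap (K : Type*) [Field K] : Module.End K (Grassmann K) →ₗ[K] (ℕ → K) where
  toFun T j := augmentation K (T (letter K j))
  map_add' _ _ := by ext j; simp
  map_smul' _ _ := by ext j; simp

theorem symbolMap_pivot (n j : ℕ) : symbolMap K (pivot K n) j = if n = j then 1 else 0 := by
  change augmentation K (pivot K n (letter K j)) = _
  rw [pivot_rec, map_add, map_mul, augmentation_letter, zero_mul, add_zero, partialD_letter]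
  split_ifs <;> simp

theorem symbolMap_monomialOp {S : Finset ℕ} (hS : S.Nonempty) (n : ℕ) :
    symbolMap K (monomialOp K S n) = 0 := by
  obtain ⟨i, hi⟩ := hS
  ext j
  change augmentation K (gMonomial K S * pivot K n (letter K j)) = _
  rw [map_mul, (((signEq_gMonomial_of_mem K hi).map (augmentation K)).trans (by
    rw [map_mul, augmentation_letter, zero_mul]; exact SignEq.refl _)).eq_zero, zero_mul]
  rfl

theorem not_finiteCodimIn {I L : Submodule K (Module.End K (Grassmann K))} {m : ℕ}
    (hI : I ≤ LinearMap.ker (symbolMap K)) (hL : ∀ n, m ≤ n → pivot K n ∈ L) :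
    ¬ FiniteCodimIn I L :=
  not_finiteCodimIn_of_dual (symbolMap K) symbolMap_pivot hI hL

theorem not_finiteDimensional_superQ : ¬ FiniteDimensional K (superQ K) := by
  intro h
  refine not_finiteCodimIn (K := K) (I := ⊥) (m := 0) bot_le (fun n _ => pivot_mem_superQ n) ?_
  exact finiteCodimIn_of_finiteDimensional h

/-! ### The ideals `Q(m)` and `x_0 Q(m)` -/

theorem isIdealOf_superQFrom (m : ℕ) :
    IsIdealOf (grassmannPart K) (superQFrom K m) (superQ K) where
  le := by rw [superQ_eq]; exact superQFrom_anti (Nat.zero_le _)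
  left_mem q hq a ha := by
    rw [superQ_eq] at hq
    have := superBracket_mem_superQFrom hq ha
    rwa [max_eq_right (Nat.zero_le _)] at this
  right_mem q hq a ha := by
    rw [superQ_eq] at hq
    have := superBracket_mem_superQFrom ha hq
    rwa [max_eq_left (Nat.zero_le _)] at this
  square_mem a ha h := square_mem_superQFrom ha h

theorem monomialOp_mul_eq_zero {S T : Finset ℕ} {n m : ℕ} (hS : 0 ∈ S) (hT : 0 ∈ T) (hn : 0 < n) :
    monomialOp K S n * monomialOp K T m = 0 := by
  have h0 : gMonomial K S * letter K 0 = 0 := by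
    have := gMonomial_mul_of_mem K hS (Finset.mem_singleton_self 0)
    simpa [gMonomial] using this
  refine (((SignEq.refl (monomialOp K S n)).mul
    (signEq_mulLeft_mul (signEq_gMonomial_of_mem K hT) (pivot K m))).trans (Or.inl ?_)).eq_zero
  refine LinearMap.ext fun f => ?_
  change gMonomial K S * pivot K n (letter K 0 * gMonomial K (T.erase 0) * pivot K m f) = 0
  rw [mul_assoc, pivot_letter_mul_of_lt hn, mul_neg, ← mul_assoc, h0, zero_mul, neg_zero]

theorem mul_eq_zero_of_mem_superQFromX0 {m : ℕ} {a b : Module.End K (Grassmann K)}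
    (ha : a ∈ superQFromX0 K m) (hb : b ∈ superQFromX0 K m) : a * b = 0 := by
  refine mul_eq_zero_of_mem_span ?_ ha hb
  rintro _ ⟨S, n, hS, -, h0, rfl⟩ _ ⟨T, l, hT, -, h0', rfl⟩
  refine monomialOp_mul_eq_zero h0 h0' ?_
  have := ((isBasisMonomial_iff K S n).1 hS).1.add_two_le h0
  omega

theorem isAbelian_superQFromX0 (m : ℕ) : IsAbelian (grassmannPart K) (superQFromX0 K m) := by
  refine ⟨fun a ha b hb => ?_, fun a ha _ => mul_eq_zero_of_mem_superQFromX0 ha ha⟩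
  refine Finset.sum_eq_zero fun s _ => Finset.sum_eq_zero fun t _ => ?_
  have h1 := isGraded_superQFromX0 m s a ha
  have h2 := isGraded_superQFromX0 m t b hb
  rw [mul_eq_zero_of_mem_superQFromX0 h1 h2, mul_eq_zero_of_mem_superQFromX0 h2 h1, smul_zero,
    sub_zero]

theorem isIdealOf_superQFromX0 {m : ℕ} (hm : 1 ≤ m) :
    IsIdealOf (grassmannPart K) (superQFromX0 K m) (superQFrom K m) where
  le := superQFromX0_le m
  left_mem _ hq _ ha := (superBracket_mem_superQFromX0 hm hq ha).1
  right_mem _ hq _ ha := (superBracket_mem_superQFromX0 hm hq ha).2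
  square_mem a ha _ := by rw [mul_eq_zero_of_mem_superQFromX0 ha ha]; exact zero_mem _

theorem superQFromX0_ne_bot (m : ℕ) : superQFromX0 K m ≠ ⊥ := by
  intro h
  have hb : IsBasisMonomial K {0} (m + 8) :=
    Or.inl ⟨by simp, by omega, by omega⟩
  have h1 : monomialOp K {0} (m + 8) ∈ superQFromX0 K m :=
    Submodule.subset_span ⟨{0}, m + 8, hb, by omega, by simp, rfl⟩
  rw [h, Submodule.mem_bot] at h1
  have h2 : gMonomial K {0} * pivot K (m + 8) (letter K (m + 8)) = 0 :=
    LinearMap.congr_fun h1 (letter K (m + 8))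
  rw [pivot_letter_self, mul_one] at h2
  have h3 : letter K 0 = 0 := by simpa [gMonomial] using h2
  have h4 := partialD_letter K 0 0
  rw [h3, map_zero, if_pos rfl] at h4
  exact zero_ne_one h4

theorem not_finiteCodimIn_superQFromX0 (m : ℕ) :
    ¬ FiniteCodimIn (superQFromX0 K m) (superQFrom K m) := by
  refine not_finiteCodimIn (m := m) ?_ fun n hn => pivot_mem_superQFrom hn
  refine Submodule.span_le.2 ?_
  rintro _ ⟨S, n, -, -, h0, rfl⟩
  exact symbolMap_monomialOp ⟨0, h0⟩ n

theorem not_justInfinite_superQFrom {m : ℕ} (hm : 1 ≤ m) :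
    ¬ JustInfinite (grassmannPart K) (superQFrom K m) := fun h =>
  not_finiteCodimIn_superQFromX0 m
    (h.2 _ (isIdealOf_superQFromX0 hm) (superQFromX0_ne_bot m))

/-! ### Leading terms -/

/-- The span of the elements `x_S v_m` with `m ≥ n` and `S ⊆ {0, …, m - 2}`. -/
def tailSpan (K : Type*) [Field K] (n : ℕ) : Submodule K (Module.End K (Grassmann K)) :=
  Submodule.span K {T | ∃ S m, n ≤ m ∧ (∀ i ∈ S, i + 2 ≤ m) ∧ T = monomialOp K S m}

/-- The span of the Grassmann monomials in `x_0, …, x_{k-1}`. -/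
def lowerPart (K : Type*) [Field K] (k : ℕ) : Submodule K (Grassmann K) :=
  Submodule.span K {f | ∃ S : Finset ℕ, (∀ i ∈ S, i < k) ∧ f = gMonomial K S}

theorem monomialOp_mem_tailSpan {S : Finset ℕ} {n m : ℕ} (h : n ≤ m) (hS : ∀ i ∈ S, i + 2 ≤ m) :
    monomialOp K S m ∈ tailSpan K n :=
  Submodule.subset_span ⟨S, m, h, hS, rfl⟩

theorem superQ_le_tailSpan : superQ K ≤ tailSpan K 0 := by
  rw [superQ_eq]
  exact superQFrom_le fun S n h _ => monomialOp_mem_tailSpan (Nat.zero_le _) fun i hi =>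
    ((isBasisMonomial_iff K S n).1 h).1.add_two_le hi

theorem eq_zero_of_forall_mem_tailSpan {a : Module.End K (Grassmann K)}
    (h : ∀ n, a ∈ tailSpan K n) : a = 0 := by
  refine LinearMap.ext fun f => ?_
  obtain ⟨N, hN⟩ := eventually_partialD_eq_zero K f
  have hle : tailSpan K N ≤ LinearMap.ker (LinearMap.applyₗ f) := by
    refine Submodule.span_le.2 ?_
    rintro _ ⟨S, m, hm, -, rfl⟩
    change gMonomial K S * pivot K m f = 0
    rw [pivot_eq_zero fun k hk => hN k (by omega), mul_zero]
  exact hle (h N)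

theorem exists_leading_of_mem_tailSpan {n : ℕ} {a : Module.End K (Grassmann K)}
    (ha : a ∈ tailSpan K n) : ∃ f ∈ lowerPart K (n - 1), ∃ R ∈ tailSpan K (n + 1),
      a = LinearMap.mulLeft K f * pivot K n + R := by
  induction ha using Submodule.span_induction with
  | mem a ha =>
    obtain ⟨S, m, hm, hS, rfl⟩ := ha
    by_cases h : m = n
    · subst h
      exact ⟨gMonomial K S, Submodule.subset_span ⟨S, fun i hi => by have := hS i hi; omega, rfl⟩,
        0, zero_mem _, by rw [add_zero, monomialOp_eq]⟩
    · exact ⟨0, zero_mem _, _, monomialOp_mem_tailSpan (by omega) hS, by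
        rw [mulLeft_zero_mul, zero_add]⟩
  | zero => exact ⟨0, zero_mem _, 0, zero_mem _, by rw [mulLeft_zero_mul, zero_add]⟩
  | add a b _ _ ha hb =>
    obtain ⟨f, hf, R, hR, rfl⟩ := ha
    obtain ⟨g, hg, R', hR', rfl⟩ := hb
    refine ⟨f + g, add_mem hf hg, R + R', add_mem hR hR', ?_⟩
    refine LinearMap.ext fun x => ?_
    simp [add_mul]; abel
  | smul c a _ ha =>
    obtain ⟨f, hf, R, hR, rfl⟩ := ha
    refine ⟨c • f, Submodule.smul_mem _ c hf, c • R, Submodule.smul_mem _ c hR, ?_⟩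
    refine LinearMap.ext fun x => ?_
    simp

theorem exists_leading {a : Module.End K (Grassmann K)} (ha : a ∈ superQ K) (h0 : a ≠ 0) :
    ∃ n, ∃ f ∈ lowerPart K (n - 1), f ≠ 0 ∧ ∃ R ∈ tailSpan K (n + 1),
      a = LinearMap.mulLeft K f * pivot K n + R := by
  classical
  have hex : ∃ n, a ∉ tailSpan K n := by
    by_contra! h
    exact h0 (eq_zero_of_forall_mem_tailSpan h)
  obtain ⟨n, hn, hmin⟩ : ∃ n, a ∈ tailSpan K n ∧ a ∉ tailSpan K (n + 1) := by
    have h1 := Nat.find_spec hex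
    have h2 : Nat.find hex ≠ 0 := fun h => by
      rw [h] at h1; exact h1 (superQ_le_tailSpan ha)
    obtain ⟨n, hn⟩ := Nat.exists_eq_succ_of_ne_zero h2
    refine ⟨n, ?_, by rwa [hn] at h1⟩
    by_contra h
    exact Nat.find_min hex (by omega) h
  obtain ⟨f, hf, R, hR, h⟩ := exists_leading_of_mem_tailSpan hn
  refine ⟨n, f, hf, ?_, R, hR, h⟩
  rintro rfl
  rw [mulLeft_zero_mul, zero_add] at h
  exact hmin (h ▸ hR)

theorem mulLeft_mul_anti_mem_tailSpan {S : Finset ℕ} {k n : ℕ} (hk : k ≤ n)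
    (hS : ∀ i ∈ S, i + 2 ≤ n) :
    LinearMap.mulLeft K (gMonomial K S) * anti K k n ∈ tailSpan K (n + 1) := by
  obtain ⟨c, D, l, hD, -, hl, -, -, hs⟩ := exists_anti (K := K) k n hk
  rw [hD, mul_smul_comm]
  refine Submodule.smul_mem _ _ ?_
  rcases mulLeft_mul_monomialOp (K := K) S D l with ⟨-, h⟩ | ⟨-, h⟩
  · rw [h.mem_iff]
    refine monomialOp_mem_tailSpan hl fun i hi => ?_
    rcases Finset.mem_union.1 hi with hi | hi
    · have := hS i hi; omega
    · rcases hs with ⟨hs, -⟩ | ⟨-, hl', -, hs⟩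
      · have := hs i hi; omega
      · have := hs i hi; omega
  · rw [h]; exact zero_mem _

theorem superBracket_pivot_mem_tailSpan {k n : ℕ} (hk : k < n) {R : Module.End K (Grassmann K)}
    (hR : R ∈ tailSpan K n) : superBracket (grassmannPart K) (pivot K k) R ∈ tailSpan K n := by
  refine superBracket_mem_span _ (s := {pivot K k}) ?_ (Submodule.mem_span_singleton_self _) hR
  rintro _ hk' _ ⟨S, m, hm, hS, rfl⟩
  rw [Set.mem_singleton_iff.1 hk', ← monomialOp_empty, superBracket_monomialOp (by simp),
    gMonomial_empty, one_mul (gMonomial K S)]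
  refine add_mem (mulLeft_mul_pivot_mem (pivot_gMonomial_mem S k) ?_) (Submodule.smul_mem _ _ ?_)
  · rintro _ ⟨j, C, hj, -, -, hC, -, rfl⟩
    rw [one_mul]
    refine monomialOp_mem_tailSpan hm fun i hi => ?_
    have := hS j hj
    rcases Finset.mem_union.1 hi with hi | hi
    · have := hC i hi; omega
    · exact hS i (Finset.mem_of_mem_erase hi)
  · have h := mulLeft_mul_anti_mem_tailSpan (K := K) (show k ≤ m by omega) hS
    refine Submodule.span_mono ?_ h
    rintro _ ⟨U, l, hl, hU, rfl⟩
    exact ⟨U, l, by omega, hU, rfl⟩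

theorem mulLeft_add_mul (f g : Grassmann K) (T : Module.End K (Grassmann K)) :
    LinearMap.mulLeft K (f + g) * T = LinearMap.mulLeft K f * T + LinearMap.mulLeft K g * T := by
  refine LinearMap.ext fun x => ?_
  simp [add_mul]

theorem mulLeft_smul_mul (c : K) (f : Grassmann K) (T : Module.End K (Grassmann K)) :
    LinearMap.mulLeft K (c • f) * T = c • (LinearMap.mulLeft K f * T) := by
  refine LinearMap.ext fun x => ?_
  simp

theorem superBracket_pivot_mulLeft {k n : ℕ} (hk : k ≤ n) {f : Grassmann K}
    (hf : f ∈ lowerPart K (n - 1)) :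
    superBracket (grassmannPart K) (pivot K k) (LinearMap.mulLeft K f * pivot K n) -
      LinearMap.mulLeft K (pivot K k f) * pivot K n ∈ tailSpan K (n + 1) := by
  simp only [← superBracketHom_apply]
  induction hf using Submodule.span_induction with
  | mem f hf =>
    obtain ⟨S, hS, rfl⟩ := hf
    have h := superBracket_monomialOp (K := K) (S := ∅) (m := n) (by simp) S k
    rw [monomialOp_empty, gMonomial_empty, one_mul, one_mul, monomialOp_eq] at h
    rw [superBracketHom_apply, h, add_sub_cancel_left]
    exact Submodule.smul_mem _ _
      (mulLeft_mul_anti_mem_tailSpan hk fun i hi => by have := hS i hi; omega)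
  | zero => simp only [map_zero, mulLeft_zero_mul, sub_zero]; exact zero_mem _
  | add f g _ _ hf hg =>
    rw [mulLeft_add_mul, map_add, map_add, mulLeft_add_mul, add_sub_add_comm]
    exact add_mem hf hg
  | smul c f _ hf =>
    rw [mulLeft_smul_mul, map_smul, map_smul, mulLeft_smul_mul]
    exact smul_sub_smul_mem c hf

theorem lowerPart_mono {k l : ℕ} (h : k ≤ l) : lowerPart K k ≤ lowerPart K l := by
  refine Submodule.span_mono ?_
  rintro _ ⟨S, hS, rfl⟩
  exact ⟨S, fun i hi => (hS i hi).trans_le h, rfl⟩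

theorem exists_of_mem_lowerPart_succ {k : ℕ} {f : Grassmann K} (hf : f ∈ lowerPart K (k + 1)) :
    ∃ g ∈ lowerPart K k, ∃ h ∈ lowerPart K k, f = g + letter K k * h := by
  induction hf using Submodule.span_induction with
  | mem f hf =>
    obtain ⟨S, hS, rfl⟩ := hf
    by_cases hk : k ∈ S
    · have h1 : gMonomial K (S.erase k) ∈ lowerPart K k :=
        Submodule.subset_span ⟨_, fun i hi => by
          rw [Finset.mem_erase] at hi
          have := hS i hi.2; omega, rfl⟩
      rcases signEq_gMonomial_of_mem K hk with h | h
      · exact ⟨0, zero_mem _, _, h1, by rw [zero_add]; exact h⟩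
      · exact ⟨0, zero_mem _, _, neg_mem h1, by rw [zero_add, mul_neg]; exact h⟩
    · refine ⟨_, Submodule.subset_span ⟨S, fun i hi => ?_, rfl⟩, 0, zero_mem _, by simp⟩
      have := hS i hi
      have : i ≠ k := fun h => hk (h ▸ hi)
      omega
  | zero => exact ⟨0, zero_mem _, 0, zero_mem _, by simp⟩
  | add f f' _ _ hf hf' =>
    obtain ⟨g, hg, h, hh, rfl⟩ := hf
    obtain ⟨g', hg', h', hh', rfl⟩ := hf'
    exact ⟨g + g', add_mem hg hg', h + h', add_mem hh hh', by rw [mul_add]; abel⟩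
  | smul c f _ hf =>
    obtain ⟨g, hg, h, hh, rfl⟩ := hf
    exact ⟨c • g, Submodule.smul_mem _ c hg, c • h, Submodule.smul_mem _ c hh, by
      rw [smul_add, mul_smul_comm]⟩

theorem pivot_of_mem_lowerPart {k : ℕ} {f : Grassmann K} (hf : f ∈ lowerPart K k) :
    pivot K k f = 0 := by
  have hle : lowerPart K k ≤ LinearMap.ker (pivot K k) := by
    refine Submodule.span_le.2 ?_
    rintro _ ⟨S, hS, rfl⟩
    exact pivot_gMonomial_of_lt hS
  exact hle hf

/-- A subspace stable under the pivot elements that contains an element with leading term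
`f v_n`, `f ≠ 0`, contains one with leading term `v_n`. -/
theorem exists_pivot_add_mem {I : Submodule K (Module.End K (Grassmann K))}
    (hI : ∀ i, ∀ a ∈ I, superBracket (grassmannPart K) (pivot K i) a ∈ I) (n k : ℕ) (hk : k ≤ n - 1) :
    ∀ f ∈ lowerPart K k, f ≠ 0 → ∀ R ∈ tailSpan K (n + 1),
      LinearMap.mulLeft K f * pivot K n + R ∈ I →
        ∃ R' ∈ tailSpan K (n + 1), pivot K n + R' ∈ I := by
  induction k with
  | zero =>
    intro f hf hf0 R hR ha
    have hle : lowerPart K 0 ≤ Submodule.span K {1} := by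
      refine Submodule.span_mono ?_
      rintro _ ⟨S, hS, rfl⟩
      rw [Finset.eq_empty_of_forall_notMem fun i hi => absurd (hS i hi) (by omega), gMonomial_empty]
      rfl
    obtain ⟨c, rfl⟩ := Submodule.mem_span_singleton.1 (hle hf)
    have hc : c ≠ 0 := by rintro rfl; exact hf0 (zero_smul _ _)
    refine ⟨c⁻¹ • R, Submodule.smul_mem _ _ hR, ?_⟩
    have h := I.smul_mem c⁻¹ ha
    have h1 : LinearMap.mulLeft K (1 : Grassmann K) * pivot K n = pivot K n := by
      refine LinearMap.ext fun x => ?_; simp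
    rwa [mulLeft_smul_mul, h1, smul_add, smul_smul, inv_mul_cancel₀ hc, one_smul] at h
  | succ k ih =>
    intro f hf hf0 R hR ha
    obtain ⟨g, hg, h, hh, rfl⟩ := exists_of_mem_lowerPart_succ hf
    by_cases h0 : h = 0
    · subst h0
      rw [mul_zero, add_zero] at ha hf0
      exact ih (by omega) g hg hf0 R hR ha
    · have h1 := hI k _ ha
      have h2 := superBracket_pivot_mulLeft (show k ≤ n by omega) (lowerPart_mono hk hf)
      have h3 := superBracket_pivot_mem_tailSpan (show k < n + 1 by omega) hR
      rw [map_add, pivot_of_mem_lowerPart hg, pivot_letter_mul_self, pivot_of_mem_lowerPart hh,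
        mul_zero, sub_zero, zero_add] at h2
      rw [← superBracketHom_apply, map_add, superBracketHom_apply, superBracketHom_apply] at h1
      refine ih (by omega) h hh h0 _ (add_mem h2 h3) ?_
      convert h1 using 1
      abel

/-! ### Nonzero ideals -/

theorem monomialOp_singleton_mem_superQ {n p : ℕ} (h : n + 3 ≤ p) (hp : 8 ≤ p) :
    monomialOp K {n} p ∈ superQ K :=
  monomialOp_mem_superQ_of_isFirstType ⟨by simpa using h, by omega, by omega⟩

theorem mulLeft_gMonomial_mul_anti {S T : Finset ℕ} {n m : ℕ} (h : n + 3 ≤ m) (hn : n ∈ T) :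
    LinearMap.mulLeft K (gMonomial K S * gMonomial K T) * anti K n m = 0 := by
  obtain ⟨c, D, l, hD, -, -, hnD, -⟩ := exists_anti (K := K) n m (by omega)
  have h1 : LinearMap.mulLeft K (gMonomial K S * gMonomial K T) =
      LinearMap.mulLeft K (gMonomial K S) * LinearMap.mulLeft K (gMonomial K T) := by
    refine LinearMap.ext fun x => ?_; simp
  rcases mulLeft_mul_monomialOp (K := K) T D l with ⟨hd, -⟩ | ⟨-, h'⟩
  · exact absurd (hnD h) (Finset.disjoint_left.1 hd hn)
  · rw [h1, hD, mul_smul_comm, mul_assoc, h', mul_zero, smul_zero]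

theorem superBracket_superBracket_eq_zero {n : ℕ} {R : Module.End K (Grassmann K)}
    (hR : R ∈ tailSpan K (n + 1)) : ∃ N, ∀ p, N ≤ p →
      superBracket (grassmannPart K) (monomialOp K {n} p) (superBracket (grassmannPart K) R
        (monomialOp K (Finset.range (p + 1)) (p + 3))) = 0 := by
  simp only [← superBracketHom_apply]
  induction hR using Submodule.span_induction with
  | mem R hR =>
    obtain ⟨S, j, hj, hS, rfl⟩ := hR
    refine ⟨j + 1, fun p hp => ?_⟩
    have hjT : j ∈ Finset.range (p + 1) := Finset.mem_range.2 (by omega)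
    rw [superBracketHom_apply, superBracketHom_apply,
      superBracket_monomialOp fun i hi => by have := hS i hi; omega,
      mulLeft_gMonomial_mul_anti (by omega) hjT, smul_zero, add_zero]
    have h1 := (SignEq.refl (gMonomial K S)).mul (pivot_gMonomial_of_mem (K := K) hjT)
    rcases S.eq_empty_or_nonempty with rfl | ⟨i, hi⟩
    · rw [gMonomial_empty, one_mul] at h1 ⊢
      rw [one_mul] at h1
      have h2 := (signEq_mulLeft_mul h1 (pivot K (p + 3))).map
        (superBracketHom (grassmannPart K) (monomialOp K {n} p))
      rw [superBracketHom_apply, superBracketHom_apply] at h2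
      refine (h2.trans (Or.inl ?_)).eq_zero
      have hnT : n ∈ (Finset.range (p + 1)).erase j := by
        rw [Finset.mem_erase, Finset.mem_range]; omega
      have hpT : p ∈ (Finset.range (p + 1)).erase j := by
        rw [Finset.mem_erase, Finset.mem_range]; omega
      have hnT' : n ∈ ((Finset.range (p + 1)).erase j).erase p := by
        rw [Finset.mem_erase]; exact ⟨by omega, hnT⟩
      rw [← monomialOp_eq, superBracket_monomialOp (by simp; omega),
        gMonomial_mul_of_mem K (Finset.mem_singleton_self n) hnT, mulLeft_zero_mul, smul_zero,
        add_zero]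
      refine ((signEq_mulLeft_mul (((SignEq.refl (gMonomial K {n})).mul
        (pivot_gMonomial_of_mem (K := K) hpT))) _).trans (Or.inl ?_)).eq_zero
      rw [gMonomial_mul_of_mem K (Finset.mem_singleton_self n) hnT', mulLeft_zero_mul]
    · have hiT : i ∈ (Finset.range (p + 1)).erase j := by
        have := hS i hi
        rw [Finset.mem_erase, Finset.mem_range]; omega
      rw [gMonomial_mul_of_mem K hi hiT] at h1
      rw [h1.eq_zero, mulLeft_zero_mul, ← superBracketHom_apply, map_zero]
  | zero => exact ⟨0, fun p _ => by simp⟩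
  | add R R' _ _ hR hR' =>
    obtain ⟨N, hN⟩ := hR
    obtain ⟨M, hM⟩ := hR'
    refine ⟨max N M, fun p hp => ?_⟩
    rw [map_add, LinearMap.add_apply, map_add, hN p (by omega), hM p (by omega), add_zero]
  | smul c R _ hR =>
    obtain ⟨N, hN⟩ := hR
    refine ⟨N, fun p hp => ?_⟩
    rw [map_smul, LinearMap.smul_apply, map_smul, hN p hp, smul_zero]

theorem signEq_superBracket_superBracket {n p : ℕ} (h : n < p) :
    SignEq (superBracket (grassmannPart K) (monomialOp K {n} p) (superBracket (grassmannPart K)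
      (pivot K n) (monomialOp K (Finset.range (p + 1)) (p + 3))))
      (monomialOp K (Finset.range p) (p + 3)) := by
  have hnT : n ∈ Finset.range (p + 1) := Finset.mem_range.2 (by omega)
  have hpT : p ∈ (Finset.range (p + 1)).erase n := by
    rw [Finset.mem_erase, Finset.mem_range]; omega
  have h1 := (superBracket_pivot_monomialOp (K := K) (n := p + 3) hnT (by omega)).map
        (superBracketHom (grassmannPart K) (monomialOp K {n} p))
  rw [superBracketHom_apply, superBracketHom_apply] at h1
  refine h1.trans ?_
  rw [superBracket_monomialOp (by simp; omega), mulLeft_gMonomial_mul_anti (by omega) hpT, smul_zero,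
    add_zero, monomialOp_eq]
  refine signEq_mulLeft_mul (((SignEq.refl (gMonomial K {n})).mul
        (pivot_gMonomial_of_mem (K := K) hpT)).trans ?_) _
  have hd : Disjoint {n} (((Finset.range (p + 1)).erase n).erase p) := by
    rw [Finset.disjoint_singleton_left, Finset.mem_erase, Finset.mem_erase]; tauto
  have h2 := gMonomial_mul_of_disjoint K hd
  have h3 : {n} ∪ ((Finset.range (p + 1)).erase n).erase p = Finset.range p := by
    ext i
    simp only [Finset.mem_union, Finset.mem_singleton, Finset.mem_erase, Finset.mem_range]
    omega
  rwa [h3] at h2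

/-- A nonzero ideal of `Q` contains some `Q(m)`. -/
theorem exists_superQFrom_le {I : Submodule K (Module.End K (Grassmann K))}
    (hI : IsIdealOf (grassmannPart K) I (superQ K)) (h0 : I ≠ ⊥) : ∃ m, superQFrom K m ≤ I := by
  have hpiv : ∀ i, ∀ a ∈ I, superBracket (grassmannPart K) (pivot K i) a ∈ I := fun i a ha =>
    hI.left_mem _ (pivot_mem_superQ i) a ha
  obtain ⟨a, ha, ha0⟩ := Submodule.exists_mem_ne_zero_of_ne_bot h0
  obtain ⟨n, f, hf, hf0, R, hR, rfl⟩ := exists_leading (hI.le ha) ha0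
  obtain ⟨R', hR', hb⟩ := exists_pivot_add_mem hpiv n (n - 1) le_rfl f hf hf0 R hR ha
  obtain ⟨N, hN⟩ := superBracket_superBracket_eq_zero hR'
  have hsub : ∀ p, N ≤ p → 8 ≤ p → n + 3 ≤ p → monomialOp K (Finset.range p) (p + 3) ∈ I := by
    intro p hp h8 hn
    have h1 := hI.left_mem _ (monomialOp_singleton_mem_superQ hn h8) _
      (hI.right_mem _ (monomialOp_range_mem_superQ (K := K) (p + 3) (by omega) (by omega)) _ hb)
    rw [show p + 3 - 2 = p + 1 by omega] at h1
    have h2 := hN p hp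
    rw [← superBracketHom_apply, ← superBracketHom_apply] at h1 h2
    rw [map_add, LinearMap.add_apply, map_add, h2, add_zero, superBracketHom_apply,
      superBracketHom_apply, (signEq_superBracket_superBracket (show n < p by omega)).mem_iff] at h1
    exact h1
  have hfull : ∀ p, N ≤ p → 8 ≤ p → n + 3 ≤ p →
      monomialOp K (Finset.range (p + 6)) (p + 8) ∈ I := by
    intro p hp h8 hn
    have h1 : monomialOp K {p, p + 1, p + 2} (p + 5) ∈ superQ K :=
      monomialOp_mem_superQ_of_isFirstType ⟨by simp, by omega, by omega⟩
    have h2 := monomialOp_mem_two (n := p + 3) (hI.right_mem _ h1 _ (hsub p hp h8 hn))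
      (by simp; omega) (by simp) (by simp)
    have h3 : Finset.range p ∪ {p, p + 1, p + 2} ∪ {p + 3, p + 3 + 1, p + 3 + 2} =
        Finset.range (p + 6) := by
      ext i
      simp only [Finset.mem_union, Finset.mem_singleton, Finset.mem_insert, Finset.mem_range]
      omega
    rwa [h3] at h2
  set M := N + n + 16 with hM
  have hfirst : ∀ S l, M ≤ l → (∀ i ∈ S, i + 3 ≤ l) → monomialOp K S l ∈ I := by
    intro S l hl hS
    have h1 := hfull (l - 8) (by omega) (by omega) (by omega)
    rw [show l - 8 + 8 = l by omega, show l - 8 + 6 = l - 2 by omega] at h1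
    refine monomialOp_mem_of_subset hpiv (fun i hi => ?_) (fun i hi _ => ?_) h1
    · have := hS i hi; rw [Finset.mem_range]; omega
    · rw [Finset.mem_range] at hi; omega
  refine ⟨M + 3, superQFrom_le fun S l hS hl => ?_⟩
  rcases hS with hS | ⟨h2, h3, hS, hS', -⟩ | ⟨-, h3, rfl⟩
  · exact hfirst S l (by omega) hS.1
  · obtain ⟨k, rfl⟩ := Nat.exists_eq_add_of_le (show 6 ≤ l by omega)
    rw [add_comm 6 k] at *
    have h4 := hfirst (Finset.range k) (k + 3) (by omega) fun i hi => by
      rw [Finset.mem_range] at hi; omega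
    have h5 := hpiv k _ h4
    rw [← monomialOp_empty] at h5
    have h6 := monomialOp_mem_three h2 h5 (by simp) (by simp) (by simp)
    rw [range_union_triple'] at h6
    refine monomialOp_mem_of_subset hpiv (fun i hi => ?_) (fun i hi hiS => ?_) h6
    · have := hS' i hi
      rw [Finset.mem_insert, Finset.mem_range]; omega
    · rw [Finset.mem_insert, Finset.mem_range] at hi
      have : i ≠ k + 6 - 2 := fun h => hiS (h ▸ hS)
      omega
  · obtain ⟨k, rfl⟩ := Nat.exists_eq_add_of_le h3
    rw [add_comm 3 k] at *
    have h4 := hfirst ∅ k (by omega) (by simp)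
    rw [monomialOp_empty] at h4
    have h5 := hI.square_mem _ h4 (pivot_mem k)
    rcases monomialOp_mul_self (K := K) (S := ∅) (n := k) (Or.inl (by simp)) with ⟨h', -⟩ | ⟨-, h'⟩
    · simp at h'
    · rw [monomialOp_empty] at h'
      rw [h'] at h5
      exact h5

theorem finiteCodimIn_of_isIdealOf {I : Submodule K (Module.End K (Grassmann K))}
    (hI : IsIdealOf (grassmannPart K) I (superQ K)) (h0 : I ≠ ⊥) : FiniteCodimIn I (superQ K) := by
  obtain ⟨m, hm⟩ := exists_superQFrom_le hI h0
  exact (finiteCodimIn_superQFrom m).mono hm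

end

end FractalQ

end

theorem mainTheorem3 (K : Type*) [Field K] :
    -- every nonzero ideal has finite codimension, and `Q` is just infinite
    (∀ I : Submodule K (Module.End K (FractalQ.Grassmann K)),
      FractalQ.IsIdealOf (FractalQ.grassmannPart K) I (FractalQ.superQ K) → I ≠ ⊥ →
        FractalQ.FiniteCodimIn I (FractalQ.superQ K)) ∧
    FractalQ.JustInfinite (FractalQ.grassmannPart K) (FractalQ.superQ K) ∧
    -- `Q(m)` is an ideal of finite codimension, and `x_0 Q(m)` is a nonzero abelian ideal of it
    -- of infinite codimension
    (∀ m : ℕ, 1 ≤ m →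
      (FractalQ.IsIdealOf (FractalQ.grassmannPart K) (FractalQ.superQFrom K m) (FractalQ.superQ K) ∧
        FractalQ.IsGraded (FractalQ.grassmannPart K) (FractalQ.superQFrom K m) ∧
        FractalQ.FiniteCodimIn (FractalQ.superQFrom K m) (FractalQ.superQ K)) ∧
      (FractalQ.IsIdealOf (FractalQ.grassmannPart K) (FractalQ.superQFromX0 K m) (FractalQ.superQFrom K m) ∧
        FractalQ.IsGraded (FractalQ.grassmannPart K) (FractalQ.superQFromX0 K m) ∧
        FractalQ.superQFromX0 K m ≠ ⊥ ∧
        FractalQ.IsAbelian (FractalQ.grassmannPart K) (FractalQ.superQFromX0 K m) ∧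
        ¬ FractalQ.FiniteCodimIn (FractalQ.superQFromX0 K m) (FractalQ.superQFrom K m)) ∧
      ¬ FractalQ.JustInfinite (FractalQ.grassmannPart K) (FractalQ.superQFrom K m)) ∧
    ¬ FractalQ.HereditaryJustInfinite (FractalQ.grassmannPart K) (FractalQ.superQ K) := by
  refine ⟨fun I hI h0 => FractalQ.finiteCodimIn_of_isIdealOf hI h0,
    ⟨FractalQ.not_finiteDimensional_superQ, fun I hI h0 => FractalQ.finiteCodimIn_of_isIdealOf hI h0⟩,
    fun m hm => ⟨⟨FractalQ.isIdealOf_superQFrom m, FractalQ.isGraded_superQFrom m,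
      FractalQ.finiteCodimIn_superQFrom m⟩,
      ⟨FractalQ.isIdealOf_superQFromX0 hm, FractalQ.isGraded_superQFromX0 m,
        FractalQ.superQFromX0_ne_bot m, FractalQ.isAbelian_superQFromX0 m,
        FractalQ.not_finiteCodimIn_superQFromX0 m⟩, FractalQ.not_justInfinite_superQFrom hm⟩,
    fun h => FractalQ.not_justInfinite_superQFrom le_rfl (h _ (FractalQ.isIdealOf_superQFrom 1)
      (FractalQ.isGraded_superQFrom 1) (FractalQ.finiteCodimIn_superQFrom 1))⟩
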